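/- **Proposition 4.1 (interlacing of Lamé eigenvalues).** Let $0<k<1$, let $\gamma=(\gamma_1,\gamma_2,\gamma_3)\in\{0,1\}^3$, put $|\gamma|=\gamma_1+\gamma_2+\gamma_3$, let $m\ge 1$ be an integer and let $n=2m+|\gamma|$. For an integer $N=2M+|\gamma|$, $M\ge 0$, let $\Lambda_N^{\gamma}$ be the set of all real $h$ for which Lamé's equation $$\varphi''(x)=\bigl(N(N+1)k^2\,\mathrm{sn}^2(x,k)-h\bigr)\varphi(x),\qquad x\in\mathbb R,$$ has a nontrivial real solution of the form $$\varphi(x)=\mathrm{sn}^{\gamma_1}(x,k)\,\mathrm{cn}^{\gamma_2}(x,k)\,\mathrm{dn}^{\gamma_3}(x,k)\,P(\mathrm{sn}^2(x,k))$$ with $P$ a polynomial of degree $M$; here $\mathrm{sn},\mathrm{cn},\mathrm{dn}$ are the Jacobi elliptic functions of modulus $k$. Then $\Lambda_n^\gamma$ has exactly $m+1$ elements $h_{1,n}^\gamma<\dots<h_{m+1,n}^\gamma$ and $\Lambda_{n+2}^\gamma$ has exactly $m+2$ elements $h_{1,n+2}^\gamma<\dots<h_{m+2,n+2}^\gamma$.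 For $M\ge 1$ and $N=2M+|\gamma|$ put $$\lambda_{j,N}^\gamma=\frac{h_{j,N}^\gamma-(1+k^2)\gamma_1-\gamma_2-k^2\gamma_3-2k^2\gamma_1\gamma_3-2\gamma_1\gamma_2}{4k^2\,M\,(M+|\gamma|+\tfrac12)}.$$ Then, for all $j=1,\dots,m+1$, $$0<\lambda_{j,n+2}^\gamma<\lambda_{j,n}^\gamma<\lambda_{j+1,n+2}^\gamma<k^{-2}.$$ -/

import Mathlib

namespace LameEquation

/-- The incomplete elliptic integral of the first kind with modulus `k`. -/
noncomputable def ellipticF (k φ : ℝ) : ℝ :=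
  ∫ θ in (0 : ℝ)..φ, 1 / Real.sqrt (1 - k ^ 2 * Real.sin θ ^ 2)

theorem one_sub_pos {k : ℝ} (hk0 : 0 < k) (hk1 : k < 1) (θ : ℝ) :
    0 < 1 - k ^ 2 * Real.sin θ ^ 2 := by
  nlinarith [Real.sin_sq_le_one θ, sq_nonneg (Real.sin θ), sq_nonneg k]

theorem continuous_integrand {k : ℝ} (hk0 : 0 < k) (hk1 : k < 1) :
    Continuous fun θ : ℝ => 1 / Real.sqrt (1 - k ^ 2 * Real.sin θ ^ 2) :=
  Continuous.div (by fun_prop) (by fun_prop)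
    fun θ => (Real.sqrt_pos.2 (one_sub_pos hk0 hk1 θ)).ne'

theorem le_ellipticF_sub {k : ℝ} (hk0 : 0 < k) (hk1 : k < 1) {a b : ℝ} (hab : a ≤ b) :
    b - a ≤ ellipticF k b - ellipticF k a := by
  have hi : ∀ x y : ℝ, IntervalIntegrable
      (fun θ : ℝ => 1 / Real.sqrt (1 - k ^ 2 * Real.sin θ ^ 2)) MeasureTheory.volume x y :=
    fun x y => (continuous_integrand hk0 hk1).intervalIntegrable x y
  unfold ellipticF
  rw [intervalIntegral.integral_interval_sub_left (hi 0 b) (hi 0 a)]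
  have h := intervalIntegral.integral_mono_on (μ := MeasureTheory.volume) (f := fun _ => (1 : ℝ))
    hab (by simp) (hi a b) (fun θ _ => by
      rw [le_div_iff₀ (Real.sqrt_pos.2 (one_sub_pos hk0 hk1 θ)), one_mul, Real.sqrt_le_iff]
      refine ⟨zero_le_one, ?_⟩
      nlinarith [mul_nonneg (sq_nonneg k) (sq_nonneg (Real.sin θ))])
  simpa using h

/-- For `0 < k < 1` the map `φ ↦ F(φ, k)` is a bijection of the real line, so that its inverse,
the amplitude function below, is a genuine inverse. -/
theorem ellipticF_bijective {k : ℝ} (hk0 : 0 < k) (hk1 : k < 1) :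
    Function.Bijective (ellipticF k) := by
  have h0 : ellipticF k 0 = 0 := by simp [ellipticF]
  constructor
  · refine StrictMono.injective fun a b hab => ?_
    have := le_ellipticF_sub hk0 hk1 hab.le
    linarith
  · have hc : Continuous (ellipticF k) :=
      intervalIntegral.continuous_primitive
        (fun a b => (continuous_integrand hk0 hk1).intervalIntegrable a b) 0
    refine hc.surjective ?_ ?_
    · refine Filter.tendsto_atTop_mono' _ ?_ Filter.tendsto_id
      filter_upwards [Filter.eventually_ge_atTop 0] with x hx
      have := le_ellipticF_sub hk0 hk1 hx
      simp only [id]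
      linarith
    · refine Filter.tendsto_atBot_mono' _ ?_ Filter.tendsto_id
      filter_upwards [Filter.eventually_le_atBot 0] with x hx
      have := le_ellipticF_sub hk0 hk1 hx
      simp only [id]
      linarith

/-- The Jacobi amplitude `am(u, k)`: the inverse function of `φ ↦ F(φ, k)`. -/
noncomputable def am (k : ℝ) : ℝ → ℝ := Function.invFun (ellipticF k)

theorem ellipticF_am {k : ℝ} (hk0 : 0 < k) (hk1 : k < 1) (u : ℝ) : ellipticF k (am k u) = u :=
  Function.rightInverse_invFun (ellipticF_bijective hk0 hk1).2 u

/-- The Jacobi elliptic function `sn(u, k)` with modulus `k`. -/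
noncomputable def sn (k u : ℝ) : ℝ := Real.sin (am k u)

/-- The Jacobi elliptic function `cn(u, k)` with modulus `k`. -/
noncomputable def cn (k u : ℝ) : ℝ := Real.cos (am k u)

/-- The Jacobi elliptic function `dn(u, k)` with modulus `k`. -/
noncomputable def dn (k u : ℝ) : ℝ := Real.sqrt (1 - k ^ 2 * sn k u ^ 2)

/-- `φ` is a nontrivial real solution, on the whole real line, of Lamé's equation
`φ'' = (n (n + 1) k² sn²(x, k) - h) φ`. -/
def IsLameEigenfunction (k : ℝ) (n : ℕ) (h : ℝ) (φ : ℝ → ℝ) : Prop :=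
  φ ≠ 0 ∧ ContDiff ℝ 2 φ ∧
    ∀ x : ℝ, deriv (deriv φ) x = ((n : ℝ) * ((n : ℝ) + 1) * k ^ 2 * sn k x ^ 2 - h) * φ x

/-- `|γ| = γ₁ + γ₂ + γ₃`; the components of `γ ∈ {0, 1}³` are `γ 0`, `γ 1`, `γ 2`. -/
def weight (γ : Fin 3 → Fin 2) : ℕ := (γ 0 : ℕ) + (γ 1 : ℕ) + (γ 2 : ℕ)

/-- The function `sn^γ₁ cn^γ₂ dn^γ₃ P(sn²)` with modulus `k`. -/
noncomputable def lameFunction (k : ℝ) (γ : Fin 3 → Fin 2) (P : Polynomial ℝ) (x : ℝ) : ℝ :=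
  sn k x ^ (γ 0 : ℕ) * cn k x ^ (γ 1 : ℕ) * dn k x ^ (γ 2 : ℕ) * P.eval (sn k x ^ 2)

/-- The set `Λ_n^γ` of all `h` having an eigenfunction `sn^γ₁ cn^γ₂ dn^γ₃ P(sn²)`, where `P` is a
polynomial of degree `m` and `n = 2 m + |γ|`. -/
def eigenvalueSet (k : ℝ) (n : ℕ) (γ : Fin 3 → Fin 2) : Set ℝ :=
  {h | ∃ (m : ℕ) (P : Polynomial ℝ), n = 2 * m + weight γ ∧ P.degree = m ∧
    IsLameEigenfunction k n h (lameFunction k γ P)}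

/-- The rescaled eigenvalue `λ` attached to an eigenvalue `h ∈ Λ_n^γ`, `n = 2 m + |γ|`, `m ≥ 1`. It
is the number `λ` for which `P` satisfies the Heine-Stieltjes equation
`P'' + ((γ₁ + 1/2)/x + (γ₂ + 1/2)/(x - 1) + (γ₃ + 1/2)/(x - k⁻²)) P'
  = m (m + |γ| + 1/2) (x - λ) / (x (x - 1) (x - k⁻²)) P`. -/
noncomputable def rescale (k : ℝ) (γ : Fin 3 → Fin 2) (m : ℕ) (h : ℝ) : ℝ :=
  let γ₁ : ℝ := ((γ 0 : ℕ) : ℝ)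
  let γ₂ : ℝ := ((γ 1 : ℕ) : ℝ)
  let γ₃ : ℝ := ((γ 2 : ℕ) : ℝ)
  (h - (1 + k ^ 2) * γ₁ - γ₂ - k ^ 2 * γ₃ - 2 * k ^ 2 * γ₁ * γ₃ - 2 * γ₁ * γ₂) /
    (4 * k ^ 2 * ((m : ℝ) * ((m : ℝ) + (weight γ : ℝ) + 1 / 2)))

end LameEquation

/-! Put $w=\mathrm{sn}^2x$, $a=k^{-2}$. Dividing out the factor
$\mathrm{sn}^{\gamma_1}\mathrm{cn}^{\gamma_2}\mathrm{dn}^{\gamma_3}$ turns Lamé's equation into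
$AP''+BP'=c\,(w-l)P$ with $A=w(w-1)(w-a)$, where $l$ is the rescaled eigenvalue and
$c=c_m=m(m+|\gamma|+\tfrac12)$ (`isLameEigenfunction_iff`). The claim becomes one about polynomial
solutions of this equation.

With the integrating factor $p$, which vanishes at $0,1,a$, the equation reads $c^{-1}(pP')'=\frac
pA(w-l)P$. Dividing by $c$ matters: $w-l$ may change sign, so a larger $c$ is not monotone in the
potential, but it is monotone in the leading coefficient. As $A>0$ on $(0,1)$ and $A<0$ on $(1,a)$,
Sturm–Picone comparison (`exists_root_Ioo_of_picone`) shows that raising $c$ never lowers the zero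
count, while raising $l$ adds zeros in $(0,1)$ and lowering it adds zeros in $(1,a)$
(`IsStieltjesSolution.rootCount_lt`).

A symmetrizable tridiagonal matrix supplies $m+1$ distinct eigenvalues
(`exists_stieltjes_eigenvalues`). Monotone zero counts and the degree bound then force the $i$-th
eigenpolynomial ($i=0,\dots,m$) to have exactly $i$ zeros in $(0,1)$ and $m-i$ in $(1,a)$, which
also excludes further eigenvalues. Since $c_m<c_{m+1}$, a violated interlacing inequality would make
some number of zeros smaller than itself. Comparison with the constant $1$ gives $0<l<a$. -/

open Polynomial Set Filter Topology

namespace LameEquation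

/-! ### Zeros of polynomial solutions and the indicial equation -/

/-- If `P` solves `(X - t) A P'' + B P' = V P` and vanishes at `t` to order `j + 1`, then
`j A(t) + B(t) = 0`. -/
theorem exists_indicial_of_isRoot {P A B V : ℝ[X]} {t : ℝ} (hP : P ≠ 0)
    (h : (X - C t) * A * derivative (derivative P) + B * derivative P = (X - C t) * V * P ∨
      (X - C t) * A * derivative (derivative P) + B * derivative P = V * P)
    (ht : P.eval t = 0) :
    ∃ j : ℕ, j * A.eval t + B.eval t = 0 ∧ (j = 0 → (derivative P).eval t ≠ 0) := by
  obtain ⟨V', hV⟩ : ∃ V', (X - C t) * A * derivative (derivative P) + B * derivative P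
      = V' * P := by
    rcases h with h | h
    · exact ⟨_, h⟩
    · exact ⟨_, h⟩
  obtain ⟨Q, hQ, hQt⟩ := exists_eq_pow_rootMultiplicity_mul_and_not_dvd P hP t
  rw [dvd_iff_isRoot, IsRoot.def] at hQt
  have hr : 0 < rootMultiplicity t P := (rootMultiplicity_pos hP).2 ht
  obtain ⟨j, hj⟩ := Nat.exists_eq_succ_of_ne_zero hr.ne'
  rw [hj] at hQ
  have hX : (X - C t : ℝ[X]) ≠ 0 := X_sub_C_ne_zero t
  set R : ℝ[X] := (j + 1 : ℝ[X]) * Q + (X - C t) * derivative Q with hR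
  have h1 : derivative P = (X - C t) ^ j * R := by
    rw [hQ, derivative_mul, derivative_X_sub_C_pow, hR]
    push_cast
    simp only [Nat.succ_eq_add_one, C_add, C_1, map_natCast]
    ring
  have h2 : (X - C t) * derivative (derivative P)
      = (X - C t) ^ j * ((j : ℝ[X]) * R + (X - C t) * derivative R) := by
    rw [h1, derivative_mul, derivative_X_sub_C_pow]
    rcases j with _ | j
    · simp
    · simp only [Nat.add_sub_cancel, map_natCast]
      ring
  -- The right side vanishes to order $j+1$ at $t$, so after cancelling $(X-t)^j$ the left side must
  -- still vanish at $t$. Its value there is $(jA(t)+B(t))R(t)$, and $R(t)=(j+1)Q(t)\ne0$.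
  have h3 : (X - C t) ^ j * (A * ((j : ℝ[X]) * R + (X - C t) * derivative R) + B * R
      - V' * ((X - C t) * Q)) = 0 := by
    have e : (X - C t) * A * derivative (derivative P)
        = A * ((X - C t) ^ j * ((j : ℝ[X]) * R + (X - C t) * derivative R)) := by
      rw [← h2]; ring
    rw [e, h1, hQ, pow_succ] at hV
    linear_combination hV
  have h4 := (mul_eq_zero.1 h3).resolve_left (pow_ne_zero _ hX)
  have h5 := congrArg (eval t) h4
  have hRt : R.eval t = (j + 1) * Q.eval t := by simp [hR]
  have hRt0 : R.eval t ≠ 0 := by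
    rw [hRt]; exact mul_ne_zero (by positivity) hQt
  simp only [eval_add, eval_sub, eval_mul, eval_natCast, eval_X, eval_C, sub_self, zero_mul,
    add_zero, mul_zero, sub_zero, eval_zero] at h5
  refine ⟨j, ?_, ?_⟩
  · have : (j * A.eval t + B.eval t) * R.eval t = 0 := by linear_combination h5
    exact (mul_eq_zero.1 this).resolve_right hRt0
  · rintro rfl
    simpa [h1] using hRt0

/-- The leading coefficient `x (x - 1) (x - a)` of the Heine–Stieltjes equation. -/
noncomputable def leadPoly (a : ℝ) : ℝ[X] := X * (X - 1) * (X - C a)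

/-- The first order coefficient of the Heine–Stieltjes equation with singularities `0, 1, a` and
exponents `α, β, γ`. -/
noncomputable def firstPoly (a α β γ : ℝ) : ℝ[X] :=
  C α * (X - 1) * (X - C a) + C β * X * (X - C a) + C γ * X * (X - 1)

/-- `P` solves `x (x - 1) (x - a) (P'' + (α / x + β / (x - 1) + γ / (x - a)) P') = c (x - l) P`. -/
def IsStieltjesSolution (a α β γ c l : ℝ) (P : ℝ[X]) : Prop :=
  leadPoly a * derivative (derivative P) + firstPoly a α β γ * derivative P
    = C c * (X - C l) * P

theorem leadPoly_eval (a x : ℝ) : (leadPoly a).eval x = x * (x - 1) * (x - a) := by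
  simp [leadPoly]

theorem firstPoly_eval (a α β γ x : ℝ) : (firstPoly a α β γ).eval x
    = α * (x - 1) * (x - a) + β * x * (x - a) + γ * x * (x - 1) := by
  simp [firstPoly]

section Roots

variable {a α β γ c l : ℝ} {P : ℝ[X]}

/-- The exponents at $0$ are $0$ and $1-\alpha$. A zero of order $j+1$ would require $j+\alpha=0$,
impossible for $\alpha>0$. The points $1$ and $a$ are handled alike. -/
theorem IsStieltjesSolution.eval_zero_ne (h : IsStieltjesSolution a α β γ c l P) (hP : P ≠ 0)
    (ha : 1 < a) (hα : 0 < α) : P.eval 0 ≠ 0 := fun h0 => by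
  obtain ⟨j, hj, -⟩ := exists_indicial_of_isRoot (A := (X - 1) * (X - C a))
    (B := firstPoly a α β γ) (V := C c * (X - C l)) hP (Or.inr (by
      rw [← h, leadPoly, C_0, sub_zero]; ring)) h0
  simp only [firstPoly_eval, eval_mul, eval_sub, eval_X, eval_one, eval_C] at hj
  have : (j + α) * a = 0 := by linear_combination hj
  have : 0 < (j + α) * a := by positivity
  linarith

theorem IsStieltjesSolution.eval_one_ne (h : IsStieltjesSolution a α β γ c l P) (hP : P ≠ 0)
    (ha : 1 < a) (hβ : 0 < β) : P.eval 1 ≠ 0 := fun h0 => by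
  obtain ⟨j, hj, -⟩ := exists_indicial_of_isRoot (A := X * (X - C a))
    (B := firstPoly a α β γ) (V := C c * (X - C l)) hP (Or.inr (by
      rw [← h, leadPoly, C_1]; ring)) h0
  simp only [firstPoly_eval, eval_mul, eval_sub, eval_X, eval_C] at hj
  have : (j + β) * (a - 1) = 0 := by linear_combination -hj
  have : 0 < (j + β) * (a - 1) := mul_pos (by positivity) (by linarith)
  linarith

theorem IsStieltjesSolution.eval_last_ne (h : IsStieltjesSolution a α β γ c l P) (hP : P ≠ 0)
    (ha : 1 < a) (hγ : 0 < γ) : P.eval a ≠ 0 := fun h0 => by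
  obtain ⟨j, hj, -⟩ := exists_indicial_of_isRoot (A := X * (X - 1))
    (B := firstPoly a α β γ) (V := C c * (X - C l)) hP (Or.inr (by
      rw [← h, leadPoly]; ring)) h0
  simp only [firstPoly_eval, eval_mul, eval_sub, eval_X, eval_one] at hj
  have : (j + γ) * (a * (a - 1)) = 0 := by linear_combination hj
  have : 0 < (j + γ) * (a * (a - 1)) :=
    mul_pos (by positivity) (mul_pos (by linarith) (by linarith))
  linarith

theorem IsStieltjesSolution.eval_derivative_ne (h : IsStieltjesSolution a α β γ c l P)
    (hP : P ≠ 0) {t : ℝ} (ht : (leadPoly a).eval t ≠ 0) (h0 : P.eval t = 0) :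
    (derivative P).eval t ≠ 0 := by
  obtain ⟨j, hj, hj'⟩ := exists_indicial_of_isRoot (A := leadPoly a) (t := t)
    (B := (X - C t) * firstPoly a α β γ) (V := C c * (X - C l)) hP (Or.inl (by
      rw [mul_assoc _ _ P, ← h]; ring)) h0
  simp only [eval_mul, eval_sub, eval_X, eval_C, sub_self, zero_mul, add_zero] at hj
  exact hj' (by simpa using (mul_eq_zero.1 hj).resolve_right ht)

end Roots

/-! ### Sturm–Picone comparison -/

/-- Covers a common zero of $f$ and $g$: the zero of $f^2$ is at least double, that of $g$ is
simple. -/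
theorem tendsto_sq_div {f g : ℝ[X]} {t : ℝ} (hf : f.eval t = 0)
    (hg : g.eval t ≠ 0 ∨ (derivative g).eval t ≠ 0) :
    Tendsto (fun x => f.eval x ^ 2 / g.eval x) (𝓝[≠] t) (𝓝 0) := by
  by_cases h0 : g.eval t = 0
  · have hg' := hg.resolve_left (not_not.2 h0)
    obtain ⟨f₁, rfl⟩ := dvd_iff_isRoot.2 hf
    obtain ⟨g₁, rfl⟩ := dvd_iff_isRoot.2 h0
    have hg₁ : g₁.eval t ≠ 0 := by simpa using hg'
    have h1 : Tendsto (fun x => (x - t) * f₁.eval x ^ 2 / g₁.eval x) (𝓝[≠] t) (𝓝 0) := by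
      have : ContinuousAt (fun x => (x - t) * f₁.eval x ^ 2 / g₁.eval x) t :=
        ContinuousAt.div (by fun_prop) (by fun_prop) hg₁
      simpa using this.tendsto.mono_left nhdsWithin_le_nhds
    refine h1.congr' ?_
    filter_upwards [self_mem_nhdsWithin] with x hx
    have hx : x - t ≠ 0 := sub_ne_zero.2 hx
    simp only [eval_mul, eval_sub, eval_X, eval_C]
    rw [mul_pow, sq (x - t), mul_assoc, mul_div_mul_left _ _ hx]
  · have : ContinuousAt (fun x => f.eval x ^ 2 / g.eval x) t :=
      ContinuousAt.div (by fun_prop) (by fun_prop) h0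
    simpa [hf] using this.tendsto.mono_left nhdsWithin_le_nhds

/-- A boundary point at which the Picone quotient `p (f f' κ - f² g' κ' / g)` tends to zero. -/
def IsPiconeEnd (p : ℝ → ℝ) (f g : ℝ[X]) (t : ℝ) : Prop :=
  (p t = 0 ∧ g.eval t ≠ 0) ∨ (f.eval t = 0 ∧ (g.eval t ≠ 0 ∨ (derivative g).eval t ≠ 0))

theorem IsPiconeEnd.tendsto {p : ℝ → ℝ} {f g : ℝ[X]} {t : ℝ} (h : IsPiconeEnd p f g t)
    (hp : Continuous p) (κ κ' : ℝ) :
    Tendsto (fun x => κ * (f.eval x * (p x * (derivative f).eval x))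
      - κ' * (f.eval x ^ 2 / g.eval x * (p x * (derivative g).eval x))) (𝓝[≠] t) (𝓝 0) := by
  have hpt : Tendsto p (𝓝[≠] t) (𝓝 (p t)) := hp.continuousAt.tendsto.mono_left nhdsWithin_le_nhds
  have hev : ∀ q : ℝ[X], Tendsto (fun x => q.eval x) (𝓝[≠] t) (𝓝 (q.eval t)) := fun q =>
    q.continuous.continuousAt.tendsto.mono_left nhdsWithin_le_nhds
  have h1 := ((hev f).mul (hpt.mul (hev (derivative f)))).const_mul κ
  rcases h with ⟨h0, hg⟩ | ⟨h0, hg⟩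
  · have h2 := ((((hev f).pow 2).div (hev g) hg).mul (hpt.mul (hev (derivative g)))).const_mul κ'
    simpa [h0] using h1.sub h2
  · have h2 := ((tendsto_sq_div h0 hg).mul (hpt.mul (hev (derivative g)))).const_mul κ'
    simpa [h0] using h1.sub h2

theorem eq_zero_of_forall_Ioo {f : ℝ[X]} {u v : ℝ} (huv : u < v)
    (h : ∀ x ∈ Ioo u v, f.eval x = 0) : f = 0 :=
  eq_zero_of_infinite_isRoot f ((Ioo_infinite huv).mono h)

/-- Sturm–Picone comparison for polynomial solutions of `κ (p f')' = ρ f`, `κ' (p g')' = σ g`. -/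
theorem exists_root_Ioo_of_picone {p ρ σ : ℝ → ℝ} {f g : ℝ[X]} {κ κ' u v : ℝ} (huv : u < v)
    (hp : Continuous p) (hp0 : ∀ x ∈ Ioo u v, 0 < p x) (hκ' : 0 < κ') (hκ : κ' ≤ κ)
    (hf : ∀ x ∈ Ioo u v, ∃ d, HasDerivAt (fun y => p y * (derivative f).eval y) d x ∧
      κ * d = ρ x * f.eval x)
    (hg : ∀ x ∈ Ioo u v, ∃ d, HasDerivAt (fun y => p y * (derivative g).eval y) d x ∧
      κ' * d = σ x * g.eval x)
    (hle : ∀ x ∈ Ioo u v, σ x ≤ ρ x)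
    (hs : (κ' < κ ∧ derivative f ≠ 0) ∨ (f ≠ 0 ∧ ∀ x ∈ Ioo u v, σ x < ρ x))
    (hu : IsPiconeEnd p f g u) (hv : IsPiconeEnd p f g v) :
    ∃ x ∈ Ioo u v, g.eval x = 0 := by
  by_contra! hne
  set F : ℝ → ℝ := fun x => κ * (f.eval x * (p x * (derivative f).eval x))
      - κ' * (f.eval x ^ 2 / g.eval x * (p x * (derivative g).eval x)) with hF
  -- Picone's identity: under the sign hypotheses the derivative is a sum of three nonnegative
  -- terms.
  have hd : ∀ x ∈ Ioo u v, HasDerivAt F ((ρ x - σ x) * f.eval x ^ 2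
      + (κ - κ') * (p x * (derivative f).eval x ^ 2)
      + κ' * (p x * ((derivative f).eval x
          - f.eval x * (derivative g).eval x / g.eval x) ^ 2)) x := by
    intro x hx
    obtain ⟨d, hd, hd'⟩ := hf x hx
    obtain ⟨e, he, he'⟩ := hg x hx
    have hgx := hne x hx
    have h1 := ((f.hasDerivAt x).mul hd).const_mul κ
    have h2 := ((((f.hasDerivAt x).pow 2).div (g.hasDerivAt x) hgx).mul he).const_mul κ'
    refine (h1.sub h2).congr_deriv ?_
    have e1 : κ * (f.eval x * d) = ρ x * f.eval x ^ 2 := by linear_combination f.eval x * hd'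
    have e2 : κ' * (f.eval x ^ 2 / g.eval x * e) = σ x * f.eval x ^ 2 := by
      have : κ' * (f.eval x ^ 2 / g.eval x * e) = f.eval x ^ 2 / g.eval x * (κ' * e) := by ring
      rw [this, he']; field_simp
    simp only [Pi.pow_apply, Pi.div_apply, Nat.cast_ofNat]
    rw [mul_add, mul_add, e1, e2]
    field_simp
    ring
  have hnn : ∀ x ∈ Ioo u v, 0 ≤ (ρ x - σ x) * f.eval x ^ 2 ∧
      0 ≤ (κ - κ') * (p x * (derivative f).eval x ^ 2) ∧
      0 ≤ κ' * (p x * ((derivative f).eval x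
          - f.eval x * (derivative g).eval x / g.eval x) ^ 2) := fun x hx =>
    ⟨mul_nonneg (sub_nonneg.2 (hle x hx)) (sq_nonneg _),
      mul_nonneg (sub_nonneg.2 hκ) (mul_nonneg (hp0 x hx).le (sq_nonneg _)),
      mul_nonneg hκ'.le (mul_nonneg (hp0 x hx).le (sq_nonneg _))⟩
  have hmono : MonotoneOn F (Ioo u v) := by
    refine monotoneOn_of_deriv_nonneg (convex_Ioo u v)
      (fun x hx => (hd x hx).continuousAt.continuousWithinAt)
      (fun x hx => ?_) (fun x hx => ?_) <;> rw [interior_Ioo] at hx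
    · exact (hd x hx).differentiableAt.differentiableWithinAt
    · rw [(hd x hx).deriv]
      obtain ⟨h1, h2, h3⟩ := hnn x hx
      linarith
  have hFu : Tendsto F (𝓝[>] u) (𝓝 0) :=
    (hu.tendsto hp κ κ').mono_left (nhdsWithin_mono _ fun x hx => ne_of_gt hx)
  have hFv : Tendsto F (𝓝[<] v) (𝓝 0) :=
    (hv.tendsto hp κ κ').mono_left (nhdsWithin_mono _ fun x hx => ne_of_lt hx)
  -- A monotone function with limit $0$ at both ends vanishes, hence so does each term of its
  -- derivative. Either alternative in `hs` contradicts this.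
  have hF0 : ∀ x ∈ Ioo u v, F x = 0 := by
    intro x hx
    apply le_antisymm
    · refine ge_of_tendsto hFv ?_
      filter_upwards [Ioo_mem_nhdsLT hx.2] with y hy
      exact hmono hx ⟨hx.1.trans hy.1, hy.2⟩ hy.1.le
    · refine le_of_tendsto hFu ?_
      filter_upwards [Ioo_mem_nhdsGT hx.1] with y hy
      exact hmono ⟨hy.1, hy.2.trans hx.2⟩ hx hy.2.le
  have hd0 : ∀ x ∈ Ioo u v, (ρ x - σ x) * f.eval x ^ 2 = 0 ∧
      (κ - κ') * (p x * (derivative f).eval x ^ 2) = 0 := by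
    intro x hx
    have h0 : HasDerivAt F 0 x := (hasDerivAt_const x (0 : ℝ)).congr_of_eventuallyEq (by
      filter_upwards [Ioo_mem_nhds hx.1 hx.2] with y hy using hF0 y hy)
    have := (hd x hx).unique h0
    obtain ⟨h1, h2, h3⟩ := hnn x hx
    constructor <;> linarith
  rcases hs with ⟨hlt, hf'⟩ | ⟨hf', hlt⟩
  · refine hf' (eq_zero_of_forall_Ioo huv fun x hx => ?_)
    have := (mul_eq_zero.1 (hd0 x hx).2).resolve_left (sub_pos.2 hlt).ne'
    exact pow_eq_zero_iff two_ne_zero |>.1 ((mul_eq_zero.1 this).resolve_left (hp0 x hx).ne')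
  · refine hf' (eq_zero_of_forall_Ioo huv fun x hx => ?_)
    have := (mul_eq_zero.1 (hd0 x hx).1).resolve_left (sub_pos.2 (hlt x hx)).ne'
    exact pow_eq_zero_iff two_ne_zero |>.1 this

/-! ### Self-adjoint form of the Heine–Stieltjes equation -/

/-- The integrating factor `|x|^α |x - 1|^β |x - a|^γ` of the Heine–Stieltjes equation. -/
noncomputable def integratingFactor (a α β γ x : ℝ) : ℝ := |x| ^ α * |x - 1| ^ β * |x - a| ^ γ

theorem hasDerivAt_abs_rpow_sub {x t : ℝ} (α : ℝ) (hx : x ≠ t) :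
    HasDerivAt (fun y => |y - t| ^ α) (α / (x - t) * |x - t| ^ α) x := by
  have hx' : x - t ≠ 0 := sub_ne_zero.2 hx
  -- `Real.log` is $\log|\cdot|$, so this one exponential represents $|y-t|^\alpha$ on both sides of
  -- $t$.
  have h := (((hasDerivAt_id x).sub_const t).log hx').mul_const α |>.exp
  have e : ∀ y, y ≠ t → |y - t| ^ α = Real.exp (Real.log (y - t) * α) := fun y hy => by
    rw [Real.rpow_def_of_pos (abs_pos.2 (sub_ne_zero.2 hy)), Real.log_abs]
  refine (h.congr_of_eventuallyEq ?_).congr_deriv ?_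
  · filter_upwards [isOpen_ne.mem_nhds hx] with y hy using e y hy
  · rw [e x hx, id]; ring

section Factor

variable {a α β γ : ℝ}

theorem continuous_integratingFactor (hα : 0 < α) (hβ : 0 < β) (hγ : 0 < γ) :
    Continuous (integratingFactor a α β γ) := by
  unfold integratingFactor
  exact ((continuous_abs.rpow_const fun _ => Or.inr hα.le).mul
    ((continuous_id.sub continuous_const).abs.rpow_const fun _ => Or.inr hβ.le)).mul
    ((continuous_id.sub continuous_const).abs.rpow_const fun _ => Or.inr hγ.le)

theorem leadPoly_eval_ne_iff {x : ℝ} :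
    (leadPoly a).eval x ≠ 0 ↔ x ≠ 0 ∧ x ≠ 1 ∧ x ≠ a := by
  simp [leadPoly_eval, sub_eq_zero, and_assoc]

theorem integratingFactor_pos {x : ℝ} (hx : (leadPoly a).eval x ≠ 0) :
    0 < integratingFactor a α β γ x := by
  obtain ⟨h0, h1, ha⟩ := leadPoly_eval_ne_iff.1 hx
  have h1 := sub_ne_zero.2 h1
  have ha := sub_ne_zero.2 ha
  unfold integratingFactor
  positivity

theorem hasDerivAt_integratingFactor_mul (q : ℝ[X]) {x : ℝ} (hx : (leadPoly a).eval x ≠ 0) :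
    HasDerivAt (fun y => integratingFactor a α β γ y * q.eval y)
      (integratingFactor a α β γ x / (leadPoly a).eval x *
        ((leadPoly a).eval x * (derivative q).eval x
          + (firstPoly a α β γ).eval x * q.eval x)) x := by
  obtain ⟨h0, h1, ha⟩ := leadPoly_eval_ne_iff.1 hx
  have d0 := hasDerivAt_abs_rpow_sub α h0
  simp only [sub_zero] at d0
  have d := ((d0.mul (hasDerivAt_abs_rpow_sub β h1)).mul (hasDerivAt_abs_rpow_sub γ ha)).mul
    (q.hasDerivAt x)
  refine d.congr_deriv ?_
  rw [leadPoly_eval, firstPoly_eval]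
  simp only [integratingFactor, Pi.mul_apply]
  have h1 := sub_ne_zero.2 h1
  have ha := sub_ne_zero.2 ha
  field_simp
  ring

end Factor

theorem IsStieltjesSolution.hasDerivAt {a α β γ c l : ℝ} {P : ℝ[X]}
    (h : IsStieltjesSolution a α β γ c l P) (hc : c ≠ 0) {x : ℝ}
    (hx : (leadPoly a).eval x ≠ 0) :
    ∃ d, HasDerivAt (fun y => integratingFactor a α β γ y * (derivative P).eval y) d x ∧
      c⁻¹ * d = integratingFactor a α β γ x / (leadPoly a).eval x * (x - l) * P.eval x := by
  refine ⟨_, hasDerivAt_integratingFactor_mul _ hx, ?_⟩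
  have := congrArg (eval x) h
  simp only [eval_add, eval_mul, eval_C, eval_sub, eval_X] at this
  rw [this]
  field_simp

/-! ### Comparison of zero counts and bounds on eigenvalues -/

/-- The number of zeros of a polynomial in an open interval. -/
noncomputable def rootCount (P : ℝ[X]) (u v : ℝ) : ℕ :=
  (P.roots.toFinset.filter fun x => x ∈ Ioo u v).card

theorem mem_roots_filter {P : ℝ[X]} (hP : P ≠ 0) {u v x : ℝ} :
    x ∈ P.roots.toFinset.filter (fun x => x ∈ Ioo u v) ↔ P.eval x = 0 ∧ x ∈ Ioo u v := by
  simp [hP]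

/-- Adjoining $u$ and $v$ to the zeros of $f$ gives two more points, and $g$ has a zero in each gap,
so the count of $f$ plus $2$ is at most the count of $g$ plus $1$. -/
theorem rootCount_lt_of_interleaved {f g : ℝ[X]} (hf : f ≠ 0) (hg : g ≠ 0) {u v : ℝ}
    (huv : u < v)
    (h : ∀ x ∈ Icc u v, ∀ y ∈ Icc u v, x < y → (f.eval x = 0 ∨ x = u) →
      (f.eval y = 0 ∨ y = v) → ∃ z ∈ Ioo x y, g.eval z = 0) :
    rootCount f u v < rootCount g u v := by
  set S := f.roots.toFinset.filter fun x => x ∈ Ioo u v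
  have hS : ∀ x ∈ S, f.eval x = 0 ∧ x ∈ Ioo u v := fun x hx => (mem_roots_filter hf).1 hx
  have hv : v ∉ S := fun hx => lt_irrefl _ (hS v hx).2.2
  have hu : u ∉ insert v S := fun hx => by
    rcases Finset.mem_insert.1 hx with hx | hx
    · exact huv.ne hx
    · exact lt_irrefl _ (hS u hx).2.1
  have key : (insert u (insert v S)).card ≤
      (g.roots.toFinset.filter fun x => x ∈ Ioo u v).card + 1 := by
    refine Finset.card_le_of_interleaved fun x hx y hy hxy _ => ?_
    simp only [Finset.mem_insert] at hx hy
    have hx' : x ∈ Icc u v := by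
      rcases hx with rfl | rfl | hx
      · exact ⟨le_rfl, huv.le⟩
      · exact ⟨huv.le, le_rfl⟩
      · exact Ioo_subset_Icc_self (hS x hx).2
    have hy' : y ∈ Icc u v := by
      rcases hy with rfl | rfl | hy
      · exact ⟨le_rfl, huv.le⟩
      · exact ⟨huv.le, le_rfl⟩
      · exact Ioo_subset_Icc_self (hS y hy).2
    obtain ⟨z, hz, hz0⟩ := h x hx' y hy' hxy
      (by
        rcases hx with hx | rfl | hx
        · exact Or.inr hx
        · exact absurd hy'.2 (not_le.2 hxy)
        · exact Or.inl (hS x hx).1)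
      (by
        rcases hy with rfl | hy | hy
        · exact absurd hx'.1 (not_le.2 hxy)
        · exact Or.inr hy
        · exact Or.inl (hS y hy).1)
    exact ⟨z, (mem_roots_filter hg).2 ⟨hz0, hx'.1.trans_lt hz.1, hz.2.trans_le hy'.2⟩, hz.1, hz.2⟩
  rw [Finset.card_insert_of_notMem hu, Finset.card_insert_of_notMem hv] at key
  exact Nat.lt_of_succ_le (Nat.le_of_succ_le_succ key)

section Comparison

variable {a α β γ c l : ℝ} {f : ℝ[X]}

theorem IsStieltjesSolution.derivative_ne_zero (h : IsStieltjesSolution a α β γ c l f)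
    (hf : f ≠ 0) (hc : c ≠ 0) : derivative f ≠ 0 := fun h0 => by
  unfold IsStieltjesSolution at h
  rw [h0] at h
  simp only [derivative_zero, mul_zero, add_zero] at h
  exact mul_ne_zero (mul_ne_zero (C_ne_zero.2 hc) (X_sub_C_ne_zero l)) hf h.symm

/-- Comparison of the numbers of zeros of two solutions in an interval between adjacent
singularities. -/
theorem IsStieltjesSolution.rootCount_lt {c' l' : ℝ} {g : ℝ[X]}
    (hf : IsStieltjesSolution a α β γ c l f) (hg : IsStieltjesSolution a α β γ c' l' g)
    (hf0 : f ≠ 0) (hg0 : g ≠ 0) (hα : 0 < α) (hβ : 0 < β) (hγ : 0 < γ)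
    (hc : 0 < c) (hcc : c ≤ c') {u v : ℝ} (huv : u < v)
    (hA : ∀ x ∈ Ioo u v, (leadPoly a).eval x ≠ 0)
    (hu : integratingFactor a α β γ u = 0) (hv : integratingFactor a α β γ v = 0)
    (hgu : g.eval u ≠ 0) (hgv : g.eval v ≠ 0)
    (hle : ∀ x ∈ Ioo u v, 0 ≤ (l' - l) / (leadPoly a).eval x)
    (hs : c < c' ∨ l ≠ l') :
    rootCount f u v < rootCount g u v := by
  have hc' : 0 < c' := hc.trans_le hcc
  refine rootCount_lt_of_interleaved hf0 hg0 huv fun x hx y hy hxy hfx hfy => ?_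
  have hsub : ∀ z ∈ Ioo x y, z ∈ Ioo u v := fun z hz => ⟨hx.1.trans_lt hz.1, hz.2.trans_le hy.2⟩
  have hdiff : ∀ z, integratingFactor a α β γ z / (leadPoly a).eval z * (z - l) =
      integratingFactor a α β γ z / (leadPoly a).eval z * (z - l') +
      integratingFactor a α β γ z * ((l' - l) / (leadPoly a).eval z) := fun z => by ring
  have hpos : ∀ z ∈ Ioo u v, 0 < integratingFactor a α β γ z := fun z hz =>
    integratingFactor_pos (hA z hz)
  -- At $u$ and $v$ the factor $p$ vanishes and $g$ does not. At an interior zero of $f$, $g$ may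
  -- vanish too, but only simply.
  have hend : ∀ z ∈ Icc u v, (f.eval z = 0 ∨ z = u ∨ z = v) →
      IsPiconeEnd (integratingFactor a α β γ) f g z := by
    intro z hz h
    by_cases hzu : z = u
    · exact Or.inl (hzu ▸ ⟨hu, hgu⟩)
    by_cases hzv : z = v
    · exact Or.inl (hzv ▸ ⟨hv, hgv⟩)
    refine Or.inr ⟨by tauto, ?_⟩
    by_cases hgz : g.eval z = 0
    · exact Or.inr (hg.eval_derivative_ne hg0
        (hA z ⟨lt_of_le_of_ne hz.1 (Ne.symm hzu), lt_of_le_of_ne hz.2 hzv⟩) hgz)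
    · exact Or.inl hgz
  refine exists_root_Ioo_of_picone hxy (continuous_integratingFactor hα hβ hγ)
    (fun z hz => hpos z (hsub z hz)) (inv_pos.2 hc') (inv_anti₀ hc hcc)
    (fun z hz => hf.hasDerivAt hc.ne' (hA z (hsub z hz)))
    (fun z hz => hg.hasDerivAt hc'.ne' (hA z (hsub z hz)))
    (fun z hz => ?_) ?_ (hend x hx (by tauto)) (hend y hy (by tauto))
  · rw [hdiff]
    have := mul_nonneg (hpos z (hsub z hz)).le (hle z (hsub z hz))
    linarith
  · rcases hs with hs | hs
    · exact Or.inl ⟨inv_strictAnti₀ hc hs, hf.derivative_ne_zero hf0 hc.ne'⟩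
    · refine Or.inr ⟨hf0, fun z hz => ?_⟩
      rw [hdiff]
      have := mul_pos (hpos z (hsub z hz)) ((hle z (hsub z hz)).lt_of_ne'
        (div_ne_zero (sub_ne_zero.2 hs.symm) (hA z (hsub z hz))))
      linarith

theorem integratingFactor_zero (hα : 0 < α) : integratingFactor a α β γ 0 = 0 := by
  simp [integratingFactor, hα.ne']

theorem integratingFactor_one (hβ : 0 < β) : integratingFactor a α β γ 1 = 0 := by
  simp [integratingFactor, hβ.ne']

theorem integratingFactor_last (hγ : 0 < γ) : integratingFactor a α β γ a = 0 := by
  simp [integratingFactor, hγ.ne']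

theorem leadPoly_eval_pos (ha : 1 < a) {x : ℝ} (hx : x ∈ Ioo (0 : ℝ) 1) :
    0 < (leadPoly a).eval x := by
  rw [leadPoly_eval]
  exact mul_pos_of_neg_of_neg (mul_neg_of_pos_of_neg hx.1 (by linarith [hx.2]))
    (by linarith [hx.2])

theorem leadPoly_eval_neg {x : ℝ} (hx : x ∈ Ioo (1 : ℝ) a) :
    (leadPoly a).eval x < 0 := by
  rw [leadPoly_eval]
  exact mul_neg_of_pos_of_neg (mul_pos (by linarith [hx.1]) (by linarith [hx.1]))
    (by linarith [hx.2])

theorem IsStieltjesSolution.rootCount_left_lt {c' l' : ℝ} {g : ℝ[X]}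
    (hf : IsStieltjesSolution a α β γ c l f) (hg : IsStieltjesSolution a α β γ c' l' g)
    (hf0 : f ≠ 0) (hg0 : g ≠ 0) (ha : 1 < a) (hα : 0 < α) (hβ : 0 < β) (hγ : 0 < γ)
    (hc : 0 < c) (hcc : c ≤ c') (hl : l ≤ l') (hs : c < c' ∨ l ≠ l') :
    rootCount f 0 1 < rootCount g 0 1 :=
  hf.rootCount_lt hg hf0 hg0 hα hβ hγ hc hcc one_pos
    (fun _ hx => (leadPoly_eval_pos ha hx).ne') (integratingFactor_zero hα)
    (integratingFactor_one hβ) (hg.eval_zero_ne hg0 ha hα) (hg.eval_one_ne hg0 ha hβ)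
    (fun _ hx => div_nonneg (sub_nonneg.2 hl) (leadPoly_eval_pos ha hx).le) hs

theorem IsStieltjesSolution.rootCount_right_lt {c' l' : ℝ} {g : ℝ[X]}
    (hf : IsStieltjesSolution a α β γ c l f) (hg : IsStieltjesSolution a α β γ c' l' g)
    (hf0 : f ≠ 0) (hg0 : g ≠ 0) (ha : 1 < a) (hα : 0 < α) (hβ : 0 < β) (hγ : 0 < γ)
    (hc : 0 < c) (hcc : c ≤ c') (hl : l' ≤ l) (hs : c < c' ∨ l ≠ l') :
    rootCount f 1 a < rootCount g 1 a :=
  hf.rootCount_lt hg hf0 hg0 hα hβ hγ hc hcc ha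
    (fun _ hx => (leadPoly_eval_neg hx).ne) (integratingFactor_one hβ)
    (integratingFactor_last hγ) (hg.eval_one_ne hg0 ha hβ) (hg.eval_last_ne hg0 ha hγ)
    (fun _ hx => div_nonneg_of_nonpos (sub_nonpos.2 hl) (leadPoly_eval_neg hx).le) hs

/-- The constant $1$ solves $(pg')'=0$. Were the potential of $f$ positive throughout, Picone
comparison would give this constant a zero. -/
theorem not_forall_potential_pos (hf : IsStieltjesSolution a α β γ c l f) (hf0 : f ≠ 0)
    (hα : 0 < α) (hβ : 0 < β) (hγ : 0 < γ) (hc : 0 < c) {u v : ℝ} (huv : u < v)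
    (hA : ∀ x ∈ Ioo u v, (leadPoly a).eval x ≠ 0)
    (hu : integratingFactor a α β γ u = 0) (hv : integratingFactor a α β γ v = 0) :
    ¬ ∀ x ∈ Ioo u v, 0 < (x - l) / (leadPoly a).eval x := fun h => by
  have hpos : ∀ x ∈ Ioo u v,
      0 < integratingFactor a α β γ x / (leadPoly a).eval x * (x - l) := fun x hx => by
    have := mul_pos (integratingFactor_pos (α := α) (β := β) (γ := γ) (hA x hx)) (h x hx)
    rwa [div_mul_eq_mul_div, ← mul_div_assoc'] at *
  obtain ⟨x, -, hx⟩ := exists_root_Ioo_of_picone (g := 1) (σ := fun _ => 0) (κ' := c⁻¹) huv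
    (continuous_integratingFactor (a := a) hα hβ hγ)
    (fun z hz => integratingFactor_pos (hA z hz)) (inv_pos.2 hc) le_rfl
    (fun z hz => hf.hasDerivAt hc.ne' (hA z hz))
    (fun z _ => ⟨0, by simpa using hasDerivAt_const z (0 : ℝ), by simp⟩)
    (fun z hz => (hpos z hz).le) (Or.inr ⟨hf0, hpos⟩) (Or.inl ⟨hu, by simp⟩)
    (Or.inl ⟨hv, by simp⟩)
  simp at hx

theorem IsStieltjesSolution.pos (hf : IsStieltjesSolution a α β γ c l f) (hf0 : f ≠ 0)
    (ha : 1 < a) (hα : 0 < α) (hβ : 0 < β) (hγ : 0 < γ) (hc : 0 < c) : 0 < l := by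
  by_contra! hl
  exact not_forall_potential_pos hf hf0 hα hβ hγ hc one_pos
    (fun _ hx => (leadPoly_eval_pos ha hx).ne') (integratingFactor_zero hα)
    (integratingFactor_one hβ)
    fun x hx => div_pos (by linarith [hx.1]) (leadPoly_eval_pos ha hx)

theorem IsStieltjesSolution.lt_last (hf : IsStieltjesSolution a α β γ c l f) (hf0 : f ≠ 0)
    (ha : 1 < a) (hα : 0 < α) (hβ : 0 < β) (hγ : 0 < γ) (hc : 0 < c) : l < a := by
  by_contra! hl
  exact not_forall_potential_pos hf hf0 hα hβ hγ hc ha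
    (fun _ hx => (leadPoly_eval_neg hx).ne) (integratingFactor_one hβ)
    (integratingFactor_last hγ)
    fun x hx => div_pos_of_neg_of_neg (by linarith [hx.2]) (leadPoly_eval_neg hx)

end Comparison

/-! ### Existence of eigenpolynomials -/

/-- A real matrix that is symmetric with respect to a positive weight has an eigenbasis. -/
theorem exists_eigenvectors_of_weighted_symm {N : ℕ} (M : Matrix (Fin N) (Fin N) ℝ)
    (w : Fin N → ℝ) (hw : ∀ i, 0 < w i) (hM : ∀ i j, w i * M i j = w j * M j i) :
    ∃ (l : Fin N → ℝ) (v : Fin N → Fin N → ℝ), LinearIndependent ℝ v ∧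
      ∀ i, M.mulVec (v i) = l i • v i := by
  have hr : ∀ i, 0 < √(w i) := fun i => Real.sqrt_pos.2 (hw i)
  have hsq : ∀ i, √(w i) * √(w i) = w i := fun i => Real.mul_self_sqrt (hw i).le
  -- With $W=\operatorname{diag}(w)$ this is $W^{1/2}MW^{-1/2}$, a symmetric matrix. The map `D`
  -- below is $W^{-1/2}$, which carries its eigenvectors back to those of $M$.
  set S : Matrix (Fin N) (Fin N) ℝ := Matrix.of fun i j => √(w i) * M i j / √(w j)
  have hS : S.IsHermitian := by
    ext i j
    simp only [S, Matrix.conjTranspose_apply, Matrix.of_apply, star_trivial]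
    rw [div_eq_div_iff (hr i).ne' (hr j).ne']
    linear_combination M j i * hsq j - M i j * hsq i - hM i j
  set b := hS.eigenvectorBasis
  let D : (Fin N → ℝ) →ₗ[ℝ] (Fin N → ℝ) :=
    { toFun := fun x j => x j / √(w j)
      map_add' := fun x y => by ext j; simp [add_div]
      map_smul' := fun r x => by ext j; simp [mul_div_assoc] }
  have hD : Function.Injective D := fun x y h => by
    ext j
    have := congrFun h j
    simpa [D, div_left_inj' (hr j).ne'] using this
  have hb : LinearIndependent ℝ fun i => (b i).ofLp := by
    have := b.toBasis.linearIndependent.map' (WithLp.linearEquiv 2 ℝ (Fin N → ℝ)).toLinearMap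
      (LinearEquiv.ker _)
    have e : (fun i => (b i).ofLp)
        = (WithLp.linearEquiv 2 ℝ (Fin N → ℝ)).toLinearMap ∘ b.toBasis := by
      ext i j
      simp
    rw [e]
    exact this
  refine ⟨hS.eigenvalues, fun i => D (b i).ofLp, hb.map' D (LinearMap.ker_eq_bot.2 hD),
    fun i => ?_⟩
  ext j
  have := congrFun (hS.mulVec_eigenvectorBasis i) j
  simp only [Matrix.mulVec, dotProduct, S, Matrix.of_apply, Pi.smul_apply, smul_eq_mul] at this
  simp only [D, Matrix.mulVec, dotProduct, LinearMap.coe_mk, AddHom.coe_mk, Pi.smul_apply,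
    smul_eq_mul]
  rw [← mul_div_assoc, eq_div_iff (hr j).ne', ← this, Finset.sum_mul]
  exact Finset.sum_congr rfl fun x _ => by ring

/-- `j (j - 1 + s)`, where `s` is the sum of the exponents. -/
noncomputable def indicial (s : ℝ) (j : ℕ) : ℝ := j * (j - 1 + s)

theorem indicial_strictMono {s : ℝ} (hs : 0 < s) : StrictMono (indicial s) := by
  refine strictMono_nat_of_lt_succ fun j => ?_
  unfold indicial
  push_cast
  have : (0 : ℝ) ≤ j := j.cast_nonneg
  nlinarith

/-- The tridiagonal matrix of the Heine–Stieltjes operator in the basis `(X - 1) ^ j`. -/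
noncomputable def stieltjesEntry (a α β γ : ℝ) (m i j : ℕ) : ℝ :=
  (if i = j + 1 then indicial (α + β + γ) m - indicial (α + β + γ) j else 0) +
  (if i = j then -((2 - a) * (j * (j - 1)) + (β * (2 - a) + γ - α * (a - 1)) * j) else 0) +
  (if i + 1 = j then (a - 1) * (j * (j - 1 + β)) else 0)

/-- Expansion at the middle singularity is essential. Since $A'(1)=1-a<0$, the raising (for $j<m$)
and lowering coefficients have the same sign, so the matrix is symmetrizable; at $0$ or $a$ the
signs would be opposite. The raising coefficient vanishes at $j=m$, so degree at most $m$ is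
preserved. -/
theorem operator_basis (a α β γ : ℝ) (m j : ℕ) (hj : j ≤ m) :
    leadPoly a * derivative (derivative ((X - 1 : ℝ[X]) ^ j))
      + firstPoly a α β γ * derivative ((X - 1 : ℝ[X]) ^ j)
      - C (indicial (α + β + γ) m) * (X - 1) * (X - 1) ^ j
      = -∑ i ∈ Finset.range (m + 1), C (stieltjesEntry a α β γ m i j) * (X - 1) ^ i := by
  have hsum : ∑ i ∈ Finset.range (m + 1), C (stieltjesEntry a α β γ m i j) * (X - 1 : ℝ[X]) ^ i
      = C (indicial (α + β + γ) m - indicial (α + β + γ) j) * (X - 1) ^ (j + 1)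
      + C (-((2 - a) * (j * (j - 1)) + (β * (2 - a) + γ - α * (a - 1)) * j)) * (X - 1) ^ j
      + C ((a - 1) * (j * (j - 1 + β))) * (X - 1) ^ (j - 1) := by
    simp only [stieltjesEntry, C_add, add_mul, Finset.sum_add_distrib]
    congr 1
    · congr 1
      · simp only [apply_ite C, C_0, ite_mul, zero_mul, Finset.sum_ite_eq', Finset.mem_range]
        split_ifs with h
        · rfl
        · have : j = m := by omega
          simp [this]
      · simp only [apply_ite C, C_0, ite_mul, zero_mul, Finset.sum_ite_eq', Finset.mem_range]
        rw [if_pos (by omega)]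
    -- At $j=0$ the exponent $j-1$ truncates to $0$, harmlessly, because its coefficient has the
    -- factor $j$.
    · rcases j with _ | j
      · simp
      · simp only [Nat.add_right_cancel_iff, apply_ite C, C_0, ite_mul, zero_mul,
          Finset.sum_ite_eq', Finset.mem_range]
        rw [if_pos (by omega)]
        simp
  rw [hsum]
  unfold leadPoly firstPoly indicial
  have hd : derivative (X - 1 : ℝ[X]) = 1 := by simp
  have h2 : (C 2 : ℝ[X]) = 2 := map_ofNat C 2
  rcases j with _ | _ | j
  · simp
  · simp [h2]
    ring
  · simp only [derivative_pow, derivative_mul, hd, Nat.add_sub_cancel, C_mul, C_add, C_sub, C_neg,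
      map_natCast, C_1, Nat.cast_add, Nat.cast_one, derivative_natCast, derivative_one,
      map_ofNat, derivative_add, mul_one, add_zero, zero_mul, zero_add,
      show j + 1 + 1 - 1 = j + 1 from rfl]
    ring

theorem stieltjesEntry_succ_left (a α β γ : ℝ) (m j : ℕ) :
    stieltjesEntry a α β γ m (j + 1) j
      = indicial (α + β + γ) m - indicial (α + β + γ) j := by
  simp [stieltjesEntry, show j + 1 + 1 ≠ j by omega]

theorem stieltjesEntry_succ_right (a α β γ : ℝ) (m j : ℕ) :
    stieltjesEntry a α β γ m j (j + 1) = (a - 1) * ((j + 1) * (j + β)) := by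
  simp [stieltjesEntry, show j ≠ j + 1 + 1 by omega]

theorem stieltjesEntry_eq_zero (a α β γ : ℝ) {m i j : ℕ} (h1 : i ≠ j + 1) (h2 : i ≠ j)
    (h3 : j ≠ i + 1) : stieltjesEntry a α β γ m i j = 0 := by
  simp [stieltjesEntry, h1, h2, h3.symm]

/-- The weight that symmetrizes the matrix `stieltjesEntry`. -/
noncomputable def stieltjesWeight (a α β γ : ℝ) (m j : ℕ) : ℝ :=
  ∏ i ∈ Finset.range j, stieltjesEntry a α β γ m i (i + 1) / stieltjesEntry a α β γ m (i + 1) i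

section Existence

variable {a α β γ : ℝ} {m : ℕ}

theorem stieltjesEntry_succ_left_pos (hs : 0 < α + β + γ) {j : ℕ} (hj : j < m) :
    0 < stieltjesEntry a α β γ m (j + 1) j := by
  rw [stieltjesEntry_succ_left]
  exact sub_pos.2 (indicial_strictMono hs hj)

theorem stieltjesWeight_pos (ha : 1 < a) (hβ : 0 < β) (hs : 0 < α + β + γ) {j : ℕ}
    (hj : j ≤ m) : 0 < stieltjesWeight a α β γ m j := by
  refine Finset.prod_pos fun i hi => div_pos ?_
    (stieltjesEntry_succ_left_pos hs ((Finset.mem_range.1 hi).trans_le hj))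
  rw [stieltjesEntry_succ_right]
  exact mul_pos (sub_pos.2 ha) (by positivity)

theorem stieltjesWeight_symm (hs : 0 < α + β + γ) {i j : ℕ} (hi : i ≤ m) (hj : j ≤ m) :
    stieltjesWeight a α β γ m i * stieltjesEntry a α β γ m i j
      = stieltjesWeight a α β γ m j * stieltjesEntry a α β γ m j i := by
  have key : ∀ j, j < m → stieltjesWeight a α β γ m (j + 1) * stieltjesEntry a α β γ m (j + 1) j
      = stieltjesWeight a α β γ m j * stieltjesEntry a α β γ m j (j + 1) := fun j hj => by
    have := (stieltjesEntry_succ_left_pos (a := a) hs hj).ne'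
    rw [stieltjesWeight, Finset.prod_range_succ, ← stieltjesWeight]
    field_simp
  by_cases h1 : i = j + 1
  · subst h1; exact key j hi
  by_cases h2 : j = i + 1
  · subst h2; exact (key i hj).symm
  by_cases h3 : i = j
  · subst h3; rfl
  rw [stieltjesEntry_eq_zero a α β γ h1 h3 h2, stieltjesEntry_eq_zero a α β γ h2 (Ne.symm h3) h1]
  simp

/-- The polynomial `∑ x_j (X - 1) ^ j`. -/
noncomputable def shiftedPoly (x : Fin (m + 1) → ℝ) : ℝ[X] := ∑ j, C (x j) * (X - 1) ^ (j : ℕ)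

theorem shiftedPoly_coeff (x : Fin (m + 1) → ℝ) (j : Fin (m + 1)) :
    ((shiftedPoly x).comp (X + 1)).coeff j = x j := by
  simp [shiftedPoly, Finset.sum_ite_eq, coeff_X_pow, Fin.val_inj]

theorem shiftedPoly_solution {x : Fin (m + 1) → ℝ} {μ : ℝ}
    (hx : (Matrix.of fun i j : Fin (m + 1) => stieltjesEntry a α β γ m i j).mulVec x = μ • x) :
    leadPoly a * derivative (derivative (shiftedPoly x))
      + firstPoly a α β γ * derivative (shiftedPoly x)
      - C (indicial (α + β + γ) m) * (X - 1) * shiftedPoly x = -C μ * shiftedPoly x := by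
  have h : ∀ j : Fin (m + 1), C (x j) * (leadPoly a * derivative (derivative ((X - 1) ^ (j : ℕ)))
      + firstPoly a α β γ * derivative ((X - 1) ^ (j : ℕ))
      - C (indicial (α + β + γ) m) * (X - 1) * (X - 1) ^ (j : ℕ))
      = -∑ i : Fin (m + 1), C (stieltjesEntry a α β γ m i j * x j) * (X - 1) ^ (i : ℕ) := by
    intro j
    rw [operator_basis a α β γ m j (Nat.lt_succ_iff.1 j.2), mul_neg, Finset.sum_range,
      Finset.mul_sum]
    congr 1
    exact Finset.sum_congr rfl fun i _ => by rw [C_mul]; ring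
  have hl : leadPoly a * derivative (derivative (shiftedPoly x))
      + firstPoly a α β γ * derivative (shiftedPoly x)
      - C (indicial (α + β + γ) m) * (X - 1) * shiftedPoly x
      = ∑ j : Fin (m + 1), C (x j) * (leadPoly a * derivative (derivative ((X - 1) ^ (j : ℕ)))
      + firstPoly a α β γ * derivative ((X - 1) ^ (j : ℕ))
      - C (indicial (α + β + γ) m) * (X - 1) * (X - 1) ^ (j : ℕ)) := by
    unfold shiftedPoly
    simp only [derivative_sum, derivative_C_mul, Finset.mul_sum]
    rw [← Finset.sum_add_distrib, ← Finset.sum_sub_distrib]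
    exact Finset.sum_congr rfl fun i _ => by ring
  rw [hl, Finset.sum_congr rfl fun j _ => h j, Finset.sum_neg_distrib, Finset.sum_comm, neg_mul,
    shiftedPoly, Finset.mul_sum]
  congr 1
  refine Finset.sum_congr rfl fun i _ => ?_
  have := congrFun hx i
  simp only [Matrix.mulVec, dotProduct, Matrix.of_apply, Pi.smul_apply, smul_eq_mul] at this
  rw [← mul_assoc, ← C_mul, ← this, ← Finset.sum_mul, map_sum]

/-- Comparison of the coefficients of $x^{d+1}$, $d=\deg P$. As `indicial` is strictly increasing,
$c$ determines the degree. -/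
theorem IsStieltjesSolution.indicial_natDegree {c l : ℝ} {P : ℝ[X]}
    (h : IsStieltjesSolution a α β γ c l P) (hP : P ≠ 0) :
    indicial (α + β + γ) P.natDegree = c := by
  set d := P.natDegree with hd
  have hA : (leadPoly a).natDegree ≤ 3 := by unfold leadPoly; compute_degree
  have hB : (firstPoly a α β γ).natDegree ≤ 2 := by unfold firstPoly; compute_degree
  have hA3 : (leadPoly a).coeff 3 = 1 := by
    have : leadPoly a = X ^ 3 + (C (-(1 + a)) * X ^ 2 + C a * X) := by
      unfold leadPoly; rw [C_neg, C_add, C_1]; ring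
    rw [this]; simp [coeff_X_pow, -map_neg, -map_add]
  have hB2 : (firstPoly a α β γ).coeff 2 = α + β + γ := by
    have : firstPoly a α β γ = C (α + β + γ) * X ^ 2
        + C (-(α * (1 + a) + β * a + γ)) * X + C (α * a) := by
      unfold firstPoly; simp only [C_add, C_1, C_neg, C_mul]; ring
    rw [this]; simp [-map_neg, -map_add]
  have h1 : (leadPoly a * derivative (derivative P)).coeff (d + 1)
      = d * (d - 1) * P.leadingCoeff := by
    by_cases h2 : 2 ≤ d
    · obtain ⟨e, he⟩ := Nat.exists_eq_add_of_le h2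
      have hdd : (derivative (derivative P)).natDegree ≤ e :=
        (natDegree_derivative_le _).trans
          (by have := natDegree_derivative_le P; omega)
      rw [show d + 1 = 3 + e by omega, coeff_mul_add_eq_of_natDegree_le hA hdd, hA3,
        coeff_derivative, coeff_derivative, leadingCoeff, ← hd, he, add_comm 2 e]
      push_cast; ring
    · have : derivative (derivative P) = 0 := by
        have := iterate_derivative_eq_zero (p := P) (x := 2) (by omega)
        simpa using this
      rw [this]
      interval_cases d <;> simp
  have h2 : (firstPoly a α β γ * derivative P).coeff (d + 1)
      = (α + β + γ) * d * P.leadingCoeff := by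
    by_cases h2 : 1 ≤ d
    · obtain ⟨e, he⟩ := Nat.exists_eq_add_of_le h2
      have hdd : (derivative P).natDegree ≤ e := by
        have := natDegree_derivative_le P; omega
      rw [show d + 1 = 2 + e by omega, coeff_mul_add_eq_of_natDegree_le hB hdd, hB2,
        coeff_derivative, leadingCoeff, ← hd, he, add_comm 1 e]
      push_cast; ring
    · have : derivative P = 0 := derivative_of_natDegree_zero (by omega)
      have h0 : d = 0 := by omega
      rw [this, h0]; simp
  have h3 : (C c * (X - C l) * P).coeff (d + 1) = c * P.leadingCoeff := by
    have hX : (C c * (X - C l)).natDegree ≤ 1 := by compute_degree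
    rw [add_comm d 1, coeff_mul_add_eq_of_natDegree_le hX le_rfl]
    simp
  have h4 := congrArg (fun q => q.coeff (d + 1)) h
  simp only [coeff_add] at h4
  rw [h1, h2, h3] at h4
  have hlc : P.leadingCoeff ≠ 0 := leadingCoeff_ne_zero.2 hP
  refine mul_right_cancel₀ hlc ?_
  unfold indicial
  linear_combination h4

/-- The Heine–Stieltjes equation has `m + 1` distinct eigenvalues with eigenpolynomials of
degree `m`. -/
theorem exists_stieltjes_eigenvalues (ha : 1 < a) (hα : 0 < α) (hβ : 0 < β) (hγ : 0 < γ)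
    (hm : 1 ≤ m) :
    ∃ (l : Fin (m + 1) → ℝ) (P : Fin (m + 1) → ℝ[X]), StrictMono l ∧
      ∀ i, P i ≠ 0 ∧ (P i).natDegree = m ∧
        IsStieltjesSolution a α β γ (indicial (α + β + γ) m) (l i) (P i) := by
  have hs : 0 < α + β + γ := by positivity
  obtain ⟨μ, v, hv, hμ⟩ := exists_eigenvectors_of_weighted_symm
    (Matrix.of fun i j : Fin (m + 1) => stieltjesEntry a α β γ m i j)
    (fun i => stieltjesWeight a α β γ m i)
    (fun i => stieltjesWeight_pos ha hβ hs (Nat.lt_succ_iff.1 i.2))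
    (fun i j => stieltjesWeight_symm hs (Nat.lt_succ_iff.1 i.2) (Nat.lt_succ_iff.1 j.2))
  set c := indicial (α + β + γ) m with hc
  have hc0 : 0 < c := by
    have := indicial_strictMono hs (show 0 < m by omega)
    rwa [show indicial (α + β + γ) 0 = 0 by simp [indicial]] at this
  -- Solves $c(x-1)-\mu=c(x-l)$ for $l$.
  set l : Fin (m + 1) → ℝ := fun i => 1 + μ i / c with hl
  set P : Fin (m + 1) → ℝ[X] := fun i => shiftedPoly (v i) with hP
  have hP0 : ∀ i, P i ≠ 0 := fun i h => hv.ne_zero i (by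
    ext j
    rw [← shiftedPoly_coeff (v i) j]
    simp only [hP] at h
    simp [h])
  have hsol : ∀ i, IsStieltjesSolution a α β γ c (l i) (P i) := fun i => by
    have h1 := shiftedPoly_solution (hμ i)
    have h2 : (C c : ℝ[X]) * C (l i) = C c + C (μ i) := by
      rw [← C_mul, ← C_add]
      congr 1
      simp only [hl]
      field_simp
    unfold IsStieltjesSolution
    linear_combination h1 + P i * h2
  have hdeg : ∀ i, (P i).natDegree = m := fun i =>
    (indicial_strictMono hs).injective ((hsol i).indicial_natDegree (hP0 i))
  have hinj : Function.Injective l := by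
    intro i i' hii
    by_contra hne
    -- For a repeated eigenvalue this combination is a solution vanishing at $1$, hence zero. That
    -- is a nontrivial relation between independent eigenvectors.
    set g : ℝ[X] := C ((P i').eval 1) * P i - C ((P i).eval 1) * P i' with hg
    have hgs : IsStieltjesSolution a α β γ c (l i) g := by
      have h1 := hsol i
      have h2 := hsol i'
      rw [← hii] at h2
      unfold IsStieltjesSolution at *
      rw [hg]
      simp only [derivative_sub, derivative_C_mul]
      linear_combination C ((P i').eval 1) * h1 - C ((P i).eval 1) * h2
    have hg0 : g = 0 := by
      by_contra h0
      exact hgs.eval_one_ne h0 ha hβ (by simp [hg]; ring)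
    have hlin : (P i').eval 1 • v i - (P i).eval 1 • v i' = 0 := by
      ext j
      have := congrArg (fun q : ℝ[X] => (q.comp (X + 1)).coeff j) hg0
      simp only [hg, hP, sub_comp, mul_comp, C_comp, coeff_sub, coeff_C_mul, shiftedPoly_coeff,
        zero_comp, coeff_zero] at this
      simpa using this
    have := (LinearIndepOn.pair_iff v hne).1 (hv.linearIndepOn _) ((P i').eval 1)
      (-(P i).eval 1) (by rw [neg_smul, ← sub_eq_add_neg, hlin])
    exact (hsol i').eval_one_ne (hP0 i') ha hβ this.1
  refine ⟨l ∘ Tuple.sort l, P ∘ Tuple.sort l,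
    (Tuple.monotone_sort l).strictMono_of_injective (hinj.comp (Tuple.sort l).injective),
    fun i => ⟨hP0 _, hdeg _, hsol _⟩⟩

/-! ### Exact zero counts and interlacing -/

theorem rootCount_add_le {f : ℝ[X]} (hf : f ≠ 0) :
    rootCount f 0 1 + rootCount f 1 a ≤ f.natDegree := by
  unfold rootCount
  rw [← Finset.card_union_of_disjoint]
  · refine (Finset.card_le_card (Finset.union_subset (Finset.filter_subset _ _)
      (Finset.filter_subset _ _))).trans ?_
    exact (Multiset.toFinset_card_le _).trans (card_roots' f)
  · rw [Finset.disjoint_left]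
    intro x hx hx'
    exact lt_irrefl x ((((mem_roots_filter hf).1 hx).2.2).trans ((mem_roots_filter hf).1 hx').2.1)

/-- The counts in $(0,1)$ strictly increase with $i$ and those in $(1,a)$ strictly decrease, so they
are at least $i$ and $m-i$. Their sum is at most the degree $m$, which forces equality. -/
theorem rootCount_eigenpolynomials {l : Fin (m + 1) → ℝ} {P : Fin (m + 1) → ℝ[X]} {c : ℝ}
    (ha : 1 < a) (hα : 0 < α) (hβ : 0 < β) (hγ : 0 < γ) (hc : 0 < c) (hl : StrictMono l)
    (h : ∀ i, P i ≠ 0 ∧ (P i).natDegree = m ∧ IsStieltjesSolution a α β γ c (l i) (P i))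
    (i : Fin (m + 1)) :
    rootCount (P i) 0 1 = i ∧ rootCount (P i) 1 a = m - i := by
  have h01 : StrictMono fun i => rootCount (P i) 0 1 := fun i j hij =>
    (h i).2.2.rootCount_left_lt (h j).2.2 (h i).1 (h j).1 ha hα hβ hγ hc le_rfl (hl hij).le
      (Or.inr (hl hij).ne)
  have h1a : StrictAnti fun i => rootCount (P i) 1 a := fun i j hij =>
    (h j).2.2.rootCount_right_lt (h i).2.2 (h j).1 (h i).1 ha hα hβ hγ hc le_rfl (hl hij).le
      (Or.inr (hl hij).ne')
  have lower : ∀ {φ : Fin (m + 1) → ℕ}, StrictMono φ → ∀ i : Fin (m + 1), (i : ℕ) ≤ φ i := by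
    intro φ hφ i
    induction i using Fin.induction with
    | zero => simp
    | succ i ih =>
      have := hφ (Fin.castSucc_lt_succ (i := i))
      simp only [Fin.val_castSucc] at ih
      simp only [Fin.val_succ]
      omega
  have e1 := lower h01 i
  have e2 := lower (h1a.comp Fin.rev_strictAnti) i.rev
  have e3 := rootCount_add_le (a := a) (h i).1
  rw [(h i).2.1] at e3
  simp only [Function.comp, Fin.rev_rev, Fin.val_rev] at e2
  constructor <;> omega

/-- Compare $f$ with the eigenpolynomial having equally many zeros in $(0,1)$: different eigenvalues
would give different counts. -/
theorem exists_eq_of_solution {l : Fin (m + 1) → ℝ} {P : Fin (m + 1) → ℝ[X]} {c l' : ℝ} {f : ℝ[X]}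
    (ha : 1 < a) (hα : 0 < α) (hβ : 0 < β) (hγ : 0 < γ) (hc : 0 < c) (hl : StrictMono l)
    (h : ∀ i, P i ≠ 0 ∧ (P i).natDegree = m ∧ IsStieltjesSolution a α β γ c (l i) (P i))
    (hf0 : f ≠ 0) (hfm : f.natDegree = m) (hf : IsStieltjesSolution a α β γ c l' f) :
    ∃ i, l i = l' := by
  have hle := rootCount_add_le (a := a) hf0
  rw [hfm] at hle
  set i : Fin (m + 1) := ⟨rootCount f 0 1, by omega⟩ with hi
  have hr := rootCount_eigenpolynomials ha hα hβ hγ hc hl h i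
  refine ⟨i, ?_⟩
  by_contra hne
  rcases lt_or_gt_of_ne hne with hlt | hlt
  · have := (h i).2.2.rootCount_left_lt hf (h i).1 hf0 ha hα hβ hγ hc le_rfl hlt.le (Or.inr hne)
    rw [hr.1] at this
    simp [hi] at this
  · have := hf.rootCount_left_lt (h i).2.2 hf0 (h i).1 ha hα hβ hγ hc le_rfl hlt.le
      (Or.inr (Ne.symm hne))
    rw [hr.1] at this
    simp [hi] at this

/-- If $l_j\le l'_j$, comparison on $(0,1)$ gives $j<j$. If $l'_{j+1}\le l_j$, comparison on $(1,a)$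
gives $m-j<(m+1)-(j+1)$. Equality is covered because $c<c'$ is strict. -/
theorem stieltjes_interlacing {l : Fin (m + 1) → ℝ} {P : Fin (m + 1) → ℝ[X]}
    {l' : Fin (m + 2) → ℝ} {P' : Fin (m + 2) → ℝ[X]} {c c' : ℝ}
    (ha : 1 < a) (hα : 0 < α) (hβ : 0 < β) (hγ : 0 < γ) (hc : 0 < c) (hcc : c < c')
    (hl : StrictMono l) (hl' : StrictMono l')
    (h : ∀ i, P i ≠ 0 ∧ (P i).natDegree = m ∧ IsStieltjesSolution a α β γ c (l i) (P i))
    (h' : ∀ i, P' i ≠ 0 ∧ (P' i).natDegree = m + 1 ∧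
      IsStieltjesSolution a α β γ c' (l' i) (P' i)) (j : Fin (m + 1)) :
    l' j.castSucc < l j ∧ l j < l' j.succ := by
  have hc' := hc.trans hcc
  have hr := rootCount_eigenpolynomials ha hα hβ hγ hc hl h j
  constructor
  · by_contra! hle
    have h1 := (h j).2.2.rootCount_left_lt (h' j.castSucc).2.2 (h j).1 (h' _).1 ha hα hβ hγ hc
      hcc.le hle (Or.inl hcc)
    rw [hr.1, (rootCount_eigenpolynomials ha hα hβ hγ hc' hl' h' _).1] at h1
    simp at h1
  · by_contra! hle
    have h1 := (h j).2.2.rootCount_right_lt (h' j.succ).2.2 (h j).1 (h' _).1 ha hα hβ hγ hc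
      hcc.le hle (Or.inl hcc)
    rw [hr.2, (rootCount_eigenpolynomials ha hα hβ hγ hc' hl' h' _).2] at h1
    simp at h1

end Existence

/-! ### Calculus of the Jacobi functions -/

section Elliptic

variable {k : ℝ}

theorem am_ellipticF (hk0 : 0 < k) (hk1 : k < 1) (φ : ℝ) : am k (ellipticF k φ) = φ :=
  Function.leftInverse_invFun (ellipticF_bijective hk0 hk1).1 φ

theorem continuous_am (hk0 : 0 < k) (hk1 : k < 1) : Continuous (am k) := by
  -- $F(\cdot,k)$ does not shrink distances, so its inverse is $1$-Lipschitz.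
  refine (LipschitzWith.of_dist_le_mul (K := 1) fun u v => ?_).continuous
  have h : ∀ u v, am k u ≤ am k v → dist (am k u) (am k v) ≤ dist u v := fun u v huv => by
    have := le_ellipticF_sub hk0 hk1 huv
    rw [ellipticF_am hk0 hk1, ellipticF_am hk0 hk1] at this
    rw [dist_comm, Real.dist_eq, abs_of_nonneg (sub_nonneg.2 huv), dist_comm, Real.dist_eq]
    exact this.trans (le_abs_self _)
  rw [NNReal.coe_one, one_mul]
  rcases le_total (am k u) (am k v) with huv | huv
  · exact h u v huv
  · rw [dist_comm, dist_comm u]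
    exact h v u huv

theorem dn_pos (hk0 : 0 < k) (hk1 : k < 1) (u : ℝ) : 0 < dn k u :=
  Real.sqrt_pos.2 (one_sub_pos hk0 hk1 _)

theorem dn_sq (hk0 : 0 < k) (hk1 : k < 1) (u : ℝ) : dn k u ^ 2 = 1 - k ^ 2 * sn k u ^ 2 :=
  Real.sq_sqrt (one_sub_pos hk0 hk1 _).le

theorem cn_sq (k u : ℝ) : cn k u ^ 2 = 1 - sn k u ^ 2 := Real.cos_sq' _

theorem hasDerivAt_am (hk0 : 0 < k) (hk1 : k < 1) (u : ℝ) : HasDerivAt (am k) (dn k u) u := by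
  have h1 := ((continuous_integrand hk0 hk1).integral_hasStrictDerivAt 0 (am k u)).hasDerivAt
  have h2 := HasDerivAt.of_local_left_inverse (continuous_am hk0 hk1).continuousAt h1
    (one_div_pos.2 (Real.sqrt_pos.2 (one_sub_pos hk0 hk1 _))).ne'
    (Eventually.of_forall (ellipticF_am hk0 hk1))
  rwa [one_div, inv_inv] at h2

theorem hasDerivAt_sn (hk0 : 0 < k) (hk1 : k < 1) (u : ℝ) :
    HasDerivAt (sn k) (cn k u * dn k u) u :=
  (Real.hasDerivAt_sin _).comp u (hasDerivAt_am hk0 hk1 u)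

theorem hasDerivAt_cn (hk0 : 0 < k) (hk1 : k < 1) (u : ℝ) :
    HasDerivAt (cn k) (-(sn k u * dn k u)) u :=
  ((Real.hasDerivAt_cos _).comp u (hasDerivAt_am hk0 hk1 u)).congr_deriv (by simp [sn])

theorem hasDerivAt_dn (hk0 : 0 < k) (hk1 : k < 1) (u : ℝ) :
    HasDerivAt (dn k) (-(k ^ 2 * (sn k u * cn k u))) u := by
  have h := ((((hasDerivAt_sn hk0 hk1 u).pow 2).const_mul (k ^ 2)).const_sub 1).sqrt
    (one_sub_pos hk0 hk1 _).ne'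
  refine h.congr_deriv ?_
  have := (dn_pos hk0 hk1 u).ne'
  change _ / (2 * dn k u) = _
  field_simp
  ring

/-- Lets identities in $\mathrm{sn}^2x$ be read as polynomial identities, at points where the factor
$\mathrm{sn}^{\gamma_1}\mathrm{cn}^{\gamma_2}\mathrm{dn}^{\gamma_3}$ can be cancelled. -/
theorem exists_sn_sq_eq (hk0 : 0 < k) (hk1 : k < 1) {w : ℝ} (hw : w ∈ Ioo (0 : ℝ) 1) :
    ∃ x, sn k x ^ 2 = w ∧ sn k x ≠ 0 ∧ cn k x ≠ 0 := by
  have hs : sn k (ellipticF k (Real.arcsin √w)) = √w := by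
    rw [sn, am_ellipticF hk0 hk1, Real.sin_arcsin (by linarith [Real.sqrt_nonneg w])
      (Real.sqrt_le_one.2 hw.2.le)]
  refine ⟨ellipticF k (Real.arcsin √w), ?_, ?_, fun h => ?_⟩
  · rw [hs, Real.sq_sqrt hw.1.le]
  · rw [hs]
    exact (Real.sqrt_pos.2 hw.1).ne'
  · have := cn_sq k (ellipticF k (Real.arcsin √w))
    rw [h, hs, Real.sq_sqrt hw.1.le] at this
    linarith [hw.2]

/-- The derivative of `sn^i cn^j dn^l` for exponents `i, j, l ≤ 1`. -/
noncomputable def gaugeDeriv (k : ℝ) (i j l : ℕ) (x : ℝ) : ℝ :=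
  i * (cn k x ^ (j + 1) * dn k x ^ (l + 1)) - j * (sn k x ^ (i + 1) * dn k x ^ (l + 1))
    - k ^ 2 * l * (sn k x ^ (i + 1) * cn k x ^ (j + 1))

/-- For $i\in\{0,1\}$ the factor $i\,\mathrm{sn}^{i-1}$ is just $i$, so no negative powers arise. -/
theorem hasDerivAt_gauge (hk0 : 0 < k) (hk1 : k < 1) {i j l : ℕ} (hi : i ≤ 1) (hj : j ≤ 1)
    (hl : l ≤ 1) (x : ℝ) :
    HasDerivAt (fun x => sn k x ^ i * cn k x ^ j * dn k x ^ l) (gaugeDeriv k i j l x) x := by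
  refine ((((hasDerivAt_sn hk0 hk1 x).pow i).mul ((hasDerivAt_cn hk0 hk1 x).pow j)).mul
    ((hasDerivAt_dn hk0 hk1 x).pow l)).congr_deriv ?_
  unfold gaugeDeriv
  interval_cases i <;> interval_cases j <;> interval_cases l <;> simp <;> ring

/-- The factor itself solves Lamé's equation with $N=|\gamma|$. Its eigenvalue is the shift
subtracted in `rescale`. -/
theorem hasDerivAt_gaugeDeriv (hk0 : 0 < k) (hk1 : k < 1) {i j l : ℕ} (hi : i ≤ 1) (hj : j ≤ 1)
    (hl : l ≤ 1) (x : ℝ) :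
    HasDerivAt (gaugeDeriv k i j l)
      ((((i + j + l : ℝ) * (i + j + l + 1)) * k ^ 2 * sn k x ^ 2 -
        ((1 + k ^ 2) * i + j + k ^ 2 * l + 2 * k ^ 2 * i * l + 2 * i * j)) *
        (sn k x ^ i * cn k x ^ j * dn k x ^ l)) x := by
  have hs := hasDerivAt_sn hk0 hk1 x
  have hc := hasDerivAt_cn hk0 hk1 x
  have hd := hasDerivAt_dn hk0 hk1 x
  refine (((((hc.pow (j + 1)).mul (hd.pow (l + 1))).const_mul (i : ℝ)).sub
    (((hs.pow (i + 1)).mul (hd.pow (l + 1))).const_mul (j : ℝ))).sub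
    (((hs.pow (i + 1)).mul (hc.pow (j + 1))).const_mul (k ^ 2 * l))).congr_deriv ?_
  have hc2 := cn_sq k x
  have hd2 := dn_sq hk0 hk1 x
  simp only [Pi.pow_apply]
  clear hs hc hd
  generalize sn k x = s at *
  generalize cn k x = c at *
  generalize dn k x = d at *
  interval_cases i <;> interval_cases j <;> interval_cases l <;> simp <;> grind

theorem gaugeDeriv_mul (k : ℝ) {i j l : ℕ} (hi : i ≤ 1) (hj : j ≤ 1) (hl : l ≤ 1) (x : ℝ) :
    gaugeDeriv k i j l x * (sn k x * cn k x * dn k x)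
      = sn k x ^ i * cn k x ^ j * dn k x ^ l *
        (i * (cn k x ^ 2 * dn k x ^ 2) - j * (sn k x ^ 2 * dn k x ^ 2)
          - l * (k ^ 2 * (sn k x ^ 2 * cn k x ^ 2))) := by
  unfold gaugeDeriv
  interval_cases i <;> interval_cases j <;> interval_cases l <;> simp <;> ring

end Elliptic

/-! ### Reduction of Lamé's equation to the Heine–Stieltjes equation -/

section Reduction

variable {k : ℝ} {γ : Fin 3 → Fin 2}

/-- For $\varphi=G\,P(w)$, $\varphi''=G''P+2G'w'P'+G(w''P'+w'^2P'')$ with $w'^2=4k^2A(w)$. The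
defect in Lamé's equation is thus $4k^2G$ times the Heine–Stieltjes defect. Stated for every $P$,
this serves both directions of the equivalence. -/
theorem exists_hasDerivAt_lameFunction (hk0 : 0 < k) (hk1 : k < 1) (γ : Fin 3 → Fin 2)
    (m : ℕ) (h : ℝ) (hm : 1 ≤ m) (P : ℝ[X]) :
    ∃ φ' : ℝ → ℝ, (∀ x, HasDerivAt (lameFunction k γ P) (φ' x) x) ∧
      ∀ x, HasDerivAt φ' ((((2 * m + weight γ : ℕ) : ℝ) * (((2 * m + weight γ : ℕ) : ℝ) + 1)
          * k ^ 2 * sn k x ^ 2 - h) * lameFunction k γ P x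
        + 4 * k ^ 2 * (sn k x ^ (γ 0 : ℕ) * cn k x ^ (γ 1 : ℕ) * dn k x ^ (γ 2 : ℕ)) *
        (leadPoly (k ^ 2)⁻¹ * derivative (derivative P)
          + firstPoly (k ^ 2)⁻¹ ((γ 0 : ℕ) + 1 / 2) ((γ 1 : ℕ) + 1 / 2) ((γ 2 : ℕ) + 1 / 2)
            * derivative P
          - C ((m : ℝ) * (m + weight γ + 1 / 2)) * (X - C (rescale k γ m h)) * P).eval
            (sn k x ^ 2)) x := by
  have hi : (γ 0 : ℕ) ≤ 1 := Nat.lt_succ_iff.1 (γ 0).2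
  have hj : (γ 1 : ℕ) ≤ 1 := Nat.lt_succ_iff.1 (γ 1).2
  have hl : (γ 2 : ℕ) ≤ 1 := Nat.lt_succ_iff.1 (γ 2).2
  have hG := hasDerivAt_gauge hk0 hk1 hi hj hl
  have hG' := hasDerivAt_gaugeDeriv hk0 hk1 hi hj hl
  have hGm := gaugeDeriv_mul k hi hj hl
  have hw : ∀ x, HasDerivAt (fun x => sn k x ^ 2) (2 * (sn k x * cn k x * dn k x)) x := fun x =>
    ((hasDerivAt_sn hk0 hk1 x).pow 2).congr_deriv (by push_cast; ring)
  have hw' : ∀ x, HasDerivAt (fun x => 2 * (sn k x * cn k x * dn k x))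
      (2 * (cn k x ^ 2 * dn k x ^ 2 - sn k x ^ 2 * dn k x ^ 2
        - k ^ 2 * (sn k x ^ 2 * cn k x ^ 2))) x := fun x =>
    ((((hasDerivAt_sn hk0 hk1 x).mul (hasDerivAt_cn hk0 hk1 x)).mul
      (hasDerivAt_dn hk0 hk1 x)).const_mul 2).congr_deriv (by simp only [Pi.mul_apply]; ring)
  have hP : ∀ (q : ℝ[X]) x, HasDerivAt (fun x => q.eval (sn k x ^ 2))
      ((derivative q).eval (sn k x ^ 2) * (2 * (sn k x * cn k x * dn k x))) x := fun q x =>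
    HasDerivAt.comp x (h₂ := fun y => q.eval y) (q.hasDerivAt (sn k x ^ 2)) (hw x)
  refine ⟨_, fun x => (hG x).mul (hP P x), fun x => ?_⟩
  refine (((hG' x).mul (hP P x)).add ((hG x).mul ((hP (derivative P) x).mul (hw' x)))).congr_deriv
    ?_
  have hGx := hGm x
  have hr : 4 * k ^ 2 * ((m : ℝ) * (m + weight γ + 1 / 2)) * rescale k γ m h
      = h - (1 + k ^ 2) * (γ 0 : ℕ) - (γ 1 : ℕ) - k ^ 2 * (γ 2 : ℕ)
        - 2 * k ^ 2 * (γ 0 : ℕ) * (γ 2 : ℕ) - 2 * (γ 0 : ℕ) * (γ 1 : ℕ) := by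
    have hm' : (0 : ℝ) < m := by exact_mod_cast hm
    have : 4 * k ^ 2 * ((m : ℝ) * (m + weight γ + 1 / 2)) ≠ 0 := by positivity
    rw [rescale, ← mul_div_assoc, mul_div_cancel_left₀ _ this]
  have hc2 := cn_sq k x
  have hd2 := dn_sq hk0 hk1 x
  have hk : k ^ 2 * (k ^ 2)⁻¹ = 1 := mul_inv_cancel₀ (by positivity)
  have hwt : (weight γ : ℝ) = (γ 0 : ℕ) + (γ 1 : ℕ) + (γ 2 : ℕ) := by simp [weight]
  simp only [lameFunction, eval_add, eval_sub, eval_mul, leadPoly_eval, firstPoly_eval, eval_C,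
    eval_X, Pi.mul_apply, Nat.cast_add, Nat.cast_mul, Nat.cast_ofNat]
  rw [hwt] at hr ⊢
  generalize rescale k γ m h = r at *
  generalize gaugeDeriv k _ _ _ x = g' at *
  generalize sn k x ^ (γ 0 : ℕ) * cn k x ^ (γ 1 : ℕ) * dn k x ^ (γ 2 : ℕ) = g at *
  generalize eval _ P = p0
  generalize eval _ (derivative P) = p1
  generalize eval _ (derivative (derivative P)) = p2
  generalize (k ^ 2)⁻¹ = b at *
  generalize ((γ 0 : ℕ) : ℝ) = i at *
  generalize ((γ 1 : ℕ) : ℝ) = j at *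
  generalize ((γ 2 : ℕ) : ℝ) = l at *
  generalize (m : ℝ) = M at *
  generalize sn k x = s at *
  generalize cn k x = c at *
  generalize dn k x = d at *
  -- Here $b=k^{-2}$. Each product becomes, up to sign, $k^2$ times two of the three factors of
  -- $A(s^2)$.
  have e1 : c ^ 2 * d ^ 2 = k ^ 2 * ((s ^ 2 - 1) * (s ^ 2 - b)) := by
    rw [hc2, hd2]; linear_combination (s ^ 2 - 1) * hk
  have e2 : s ^ 2 * d ^ 2 = -(k ^ 2 * (s ^ 2 * (s ^ 2 - b))) := by
    rw [hd2]; linear_combination -s ^ 2 * hk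
  have e3 : k ^ 2 * (s ^ 2 * c ^ 2) = -(k ^ 2 * (s ^ 2 * (s ^ 2 - 1))) := by
    rw [hc2]; ring
  linear_combination 4 * p1 * hGx - g * p0 * hr + (4 * g * p2 * s ^ 2 + g * p1 * (4 * i + 2)) * e1
    - g * p1 * (4 * j + 2) * e2 - g * p1 * (4 * l + 2) * e3

theorem lameFunction_ne_zero (hk0 : 0 < k) (hk1 : k < 1) {P : ℝ[X]} (hP : P ≠ 0) :
    lameFunction k γ P ≠ 0 := fun h => hP (eq_zero_of_forall_Ioo one_pos fun w hw => by
  obtain ⟨x, rfl, hs, hc⟩ := exists_sn_sq_eq hk0 hk1 hw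
  have := congrFun h x
  simp only [lameFunction, Pi.zero_apply] at this
  exact (mul_eq_zero.1 this).resolve_left (mul_ne_zero (mul_ne_zero (pow_ne_zero _ hs)
    (pow_ne_zero _ hc)) (pow_ne_zero _ (dn_pos hk0 hk1 x).ne')))

theorem indicial_eq (γ : Fin 3 → Fin 2) (m : ℕ) :
    indicial (((γ 0 : ℕ) + 1 / 2 : ℝ) + ((γ 1 : ℕ) + 1 / 2) + ((γ 2 : ℕ) + 1 / 2)) m
      = m * (m + weight γ + 1 / 2) := by
  simp only [indicial, weight]
  push_cast
  ring

/-- The Heine–Stieltjes equation attached to Lamé's equation. -/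
def IsLameSolution (k : ℝ) (γ : Fin 3 → Fin 2) (m : ℕ) (l : ℝ) (P : ℝ[X]) : Prop :=
  IsStieltjesSolution (k ^ 2)⁻¹ ((γ 0 : ℕ) + 1 / 2) ((γ 1 : ℕ) + 1 / 2) ((γ 2 : ℕ) + 1 / 2)
    (indicial (((γ 0 : ℕ) + 1 / 2 : ℝ) + ((γ 1 : ℕ) + 1 / 2) + ((γ 2 : ℕ) + 1 / 2)) m) l P

theorem isLameEigenfunction_iff (hk0 : 0 < k) (hk1 : k < 1) {m : ℕ} (hm : 1 ≤ m) {h : ℝ}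
    {P : ℝ[X]} (hP : P ≠ 0) :
    IsLameEigenfunction k (2 * m + weight γ) h (lameFunction k γ P) ↔
      IsLameSolution k γ m (rescale k γ m h) P := by
  obtain ⟨φ', h1, h2⟩ := exists_hasDerivAt_lameFunction hk0 hk1 γ m h hm P
  have d1 : deriv (lameFunction k γ P) = φ' := funext fun x => (h1 x).deriv
  unfold IsLameSolution IsStieltjesSolution
  rw [indicial_eq]
  constructor
  · rintro ⟨-, -, hode⟩
    rw [← sub_eq_zero]
    refine eq_zero_of_forall_Ioo one_pos fun w hw => ?_
    obtain ⟨x, rfl, hs, hc⟩ := exists_sn_sq_eq hk0 hk1 hw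
    have e := hode x
    rw [d1, (h2 x).deriv, add_eq_left] at e
    exact (mul_eq_zero.1 e).resolve_left (mul_ne_zero (by positivity)
      (mul_ne_zero (mul_ne_zero (pow_ne_zero _ hs) (pow_ne_zero _ hc))
        (pow_ne_zero _ (dn_pos hk0 hk1 x).ne')))
  · intro hsol
    rw [← sub_eq_zero] at hsol
    simp only [hsol, eval_zero, mul_zero, add_zero] at h2
    have d2 : deriv φ' = _ := funext fun x => (h2 x).deriv
    have hφ : Continuous (lameFunction k γ P) :=
      continuous_iff_continuousAt.2 fun x => (h1 x).continuousAt
    have hsn : Continuous (sn k) := Real.continuous_sin.comp (continuous_am hk0 hk1)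
    refine ⟨lameFunction_ne_zero hk0 hk1 hP, ?_, fun x => by rw [d1, (h2 x).deriv]⟩
    rw [show (2 : WithTop ℕ∞) = 1 + 1 by norm_num, contDiff_succ_iff_deriv]
    refine ⟨fun x => (h1 x).differentiableAt, by simp, ?_⟩
    rw [d1, contDiff_one_iff_deriv, d2]
    exact ⟨fun x => (h2 x).differentiableAt, by fun_prop⟩

theorem mem_eigenvalueSet_iff (hk0 : 0 < k) (hk1 : k < 1) {m : ℕ} (hm : 1 ≤ m) {h : ℝ} :
    h ∈ eigenvalueSet k (2 * m + weight γ) γ ↔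
      ∃ P : ℝ[X], P ≠ 0 ∧ P.natDegree = m ∧ IsLameSolution k γ m (rescale k γ m h) P := by
  constructor
  · rintro ⟨m', P, hmm, hdeg, hP⟩
    obtain rfl : m' = m := by omega
    have hP0 : P ≠ 0 := fun h0 => by simp [h0] at hdeg
    exact ⟨P, hP0, natDegree_eq_of_degree_eq_some hdeg,
      (isLameEigenfunction_iff hk0 hk1 hm hP0).1 hP⟩
  · rintro ⟨P, hP0, hdeg, hP⟩
    exact ⟨m, P, rfl, by rw [degree_eq_natDegree hP0, hdeg],
      (isLameEigenfunction_iff hk0 hk1 hm hP0).2 hP⟩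

/-- The inverse of `rescale`. -/
noncomputable def unscale (k : ℝ) (γ : Fin 3 → Fin 2) (m : ℕ) (l : ℝ) : ℝ :=
  4 * k ^ 2 * ((m : ℝ) * ((m : ℝ) + (weight γ : ℝ) + 1 / 2)) * l +
    ((1 + k ^ 2) * (γ 0 : ℕ) + (γ 1 : ℕ) + k ^ 2 * (γ 2 : ℕ)
      + 2 * k ^ 2 * (γ 0 : ℕ) * (γ 2 : ℕ) + 2 * (γ 0 : ℕ) * (γ 1 : ℕ))

theorem rescale_factor_pos (hk0 : 0 < k) (γ : Fin 3 → Fin 2) {m : ℕ} (hm : 1 ≤ m) :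
    0 < 4 * k ^ 2 * ((m : ℝ) * ((m : ℝ) + (weight γ : ℝ) + 1 / 2)) := by
  have : (0 : ℝ) < m := by exact_mod_cast hm
  positivity

theorem rescale_unscale (hk0 : 0 < k) {m : ℕ} (hm : 1 ≤ m) (l : ℝ) :
    rescale k γ m (unscale k γ m l) = l := by
  rw [rescale, div_eq_iff (rescale_factor_pos hk0 γ hm).ne', unscale]
  ring

theorem unscale_rescale (hk0 : 0 < k) {m : ℕ} (hm : 1 ≤ m) (h : ℝ) :
    unscale k γ m (rescale k γ m h) = h := by
  rw [unscale, rescale, mul_div_cancel₀ _ (rescale_factor_pos hk0 γ hm).ne']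
  ring

theorem unscale_strictMono (hk0 : 0 < k) {m : ℕ} (hm : 1 ≤ m) :
    StrictMono (unscale k γ m) := fun _ _ hxy =>
  (add_lt_add_iff_right _).2 (mul_lt_mul_of_pos_left hxy (rescale_factor_pos hk0 γ hm))

theorem exists_lame_eigenvalues (hk0 : 0 < k) (hk1 : k < 1) (γ : Fin 3 → Fin 2) {m : ℕ}
    (hm : 1 ≤ m) :
    ∃ (l : Fin (m + 1) → ℝ) (P : Fin (m + 1) → ℝ[X]), StrictMono l ∧
      (∀ i, P i ≠ 0 ∧ (P i).natDegree = m ∧ IsLameSolution k γ m (l i) (P i)) ∧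
      Set.range (unscale k γ m ∘ l) = eigenvalueSet k (2 * m + weight γ) γ := by
  have ha : 1 < (k ^ 2)⁻¹ :=
    (one_lt_inv₀ (by positivity)).2 (pow_lt_one₀ hk0.le hk1 two_ne_zero)
  have hc : 0 < indicial (((γ 0 : ℕ) + 1 / 2 : ℝ) + ((γ 1 : ℕ) + 1 / 2) + ((γ 2 : ℕ) + 1 / 2)) m
      := by
    have : (0 : ℝ) < m := by exact_mod_cast hm
    rw [indicial_eq]
    positivity
  have hpos : ∀ i : Fin 3, (0 : ℝ) < (γ i : ℕ) + 1 / 2 := fun i => by positivity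
  obtain ⟨l, P, hl, hP⟩ := exists_stieltjes_eigenvalues ha (hpos 0) (hpos 1) (hpos 2) hm
  refine ⟨l, P, hl, hP, ?_⟩
  ext h
  rw [mem_eigenvalueSet_iff hk0 hk1 hm]
  constructor
  · rintro ⟨i, rfl⟩
    refine ⟨P i, (hP i).1, (hP i).2.1, ?_⟩
    rw [Function.comp, rescale_unscale hk0 hm]
    exact (hP i).2.2
  · rintro ⟨f, hf0, hfm, hf⟩
    obtain ⟨i, hi⟩ := exists_eq_of_solution ha (hpos 0) (hpos 1) (hpos 2) hc hl hP hf0 hfm hf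
    exact ⟨i, by rw [Function.comp, hi, unscale_rescale hk0 hm]⟩

end Reduction

end LameEquation

theorem proposition4p1 (k : ℝ) (hk0 : 0 < k) (hk1 : k < 1) (γ : Fin 3 → Fin 2) (m n : ℕ)
    (hm : 1 ≤ m) (hn : n = 2 * m + LameEquation.weight γ) :
    ∃ (h : Fin (m + 1) → ℝ) (h' : Fin (m + 2) → ℝ),
      StrictMono h ∧ Set.range h = LameEquation.eigenvalueSet k n γ ∧
      StrictMono h' ∧ Set.range h' = LameEquation.eigenvalueSet k (n + 2) γ ∧
      ∀ j : Fin (m + 1),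
        0 < LameEquation.rescale k γ (m + 1) (h' j.castSucc) ∧
        LameEquation.rescale k γ (m + 1) (h' j.castSucc) < LameEquation.rescale k γ m (h j) ∧
        LameEquation.rescale k γ m (h j) < LameEquation.rescale k γ (m + 1) (h' j.succ) ∧
        LameEquation.rescale k γ (m + 1) (h' j.succ) < (k ^ 2)⁻¹ := by
  open LameEquation in
  subst hn
  have hm' : 1 ≤ m + 1 := by omega
  obtain ⟨l, P, hl, hP, hr⟩ := exists_lame_eigenvalues hk0 hk1 γ hm
  obtain ⟨l', P', hl', hP', hr'⟩ := exists_lame_eigenvalues hk0 hk1 γ hm'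
  refine ⟨unscale k γ m ∘ l, unscale k γ (m + 1) ∘ l', (unscale_strictMono hk0 hm).comp hl, hr,
    (unscale_strictMono hk0 hm').comp hl', ?_, fun j => ?_⟩
  · rw [hr']
    congr 1
    ring
  have ha : 1 < (k ^ 2)⁻¹ :=
    (one_lt_inv₀ (by positivity)).2 (pow_lt_one₀ hk0.le hk1 two_ne_zero)
  have hpos : ∀ i : Fin 3, (0 : ℝ) < (γ i : ℕ) + 1 / 2 := fun i => by positivity
  have hmono := indicial_strictMono (add_pos (add_pos (hpos 0) (hpos 1)) (hpos 2))
  have hc : 0 < indicial (((γ 0 : ℕ) + 1 / 2 : ℝ) + ((γ 1 : ℕ) + 1 / 2) + ((γ 2 : ℕ) + 1 / 2)) m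
      := by
    have : (0 : ℝ) < m := by exact_mod_cast hm
    rw [indicial_eq]
    positivity
  -- The strict growth $c_m<c_{m+1}$ drives the interlacing.
  have hcc := hmono (Nat.lt_succ_self m)
  obtain ⟨h1, h2⟩ := stieltjes_interlacing ha (hpos 0) (hpos 1) (hpos 2) hc hcc hl hl' hP hP' j
  simp only [Function.comp, rescale_unscale hk0 hm, rescale_unscale hk0 hm']
  exact ⟨(hP' _).2.2.pos (hP' _).1 ha (hpos 0) (hpos 1) (hpos 2) (hc.trans hcc), h1, h2,
    (hP' _).2.2.lt_last (hP' _).1 ha (hpos 0) (hpos 1) (hpos 2) (hc.trans hcc)⟩
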